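/- Let $V$ be a set (alphabet) and $V_0\subseteq V$ a subset. Let $\mathbb{Q}\langle V\rangle=\mathcal U(\mathrm{Lie}(V))$ be the free associative algebra, with unit $\mathbf 1$ (the empty word), the shuffle coproduct $\Delta(v)=v\otimes\mathbf 1+\mathbf 1\otimes v$ for letters $v\in V$ (extended as an algebra morphism, $\Delta(A)=A_{(1)}\otimes A_{(2)}$), the anti-morphism $S$ with $S(v)=-v$ for $v\in V$, the shuffle product $\star$ (dual to $\Delta$), and the pairing $(-\mid-)$ for which the words form an orthonormal basis. Let $\triangleright$ be the post-Lie product on the free Lie algebra $\mathrm{Lie}(V)\subset\mathbb{Q}\langle V\rangle$ for which each $t\,\triangleright$ with $t\in\mathrm{Lie}(V)$ is the derivation with $t\triangleright v=0$ for $v\in V_0$ and $t\triangleright v=[v,t]$ for $v\in V\setminus V_0$. Extend it to the unique bilinear map $\triangleright$ on $\mathbb{Q}\langle V\rangle$ with $A\triangleright\mathbf 1=(A\mid\mathbf 1)\mathbf 1$, $\mathbf 1\triangleright A=A$, $(xA)\triangleright y=x\triangleright(A\triangleright y)-(x\triangleright A)\triangleright y$ and $A\triangleright(BC)=(A_{(1)}\triangleright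 B)(A_{(2)}\triangleright C)$ for $x,y\in\mathrm{Lie}(V)$ and $A,B,C\in\mathbb{Q}\langle V\rangle$. Let $A\circledast B=A_{(1)}(A_{(2)}\triangleright B)$ be its Grossman–Larson product. **(1)** The linear map $\Delta_I:\mathbb{Q}\langle V\rangle\to\mathbb{Q}\langle V\rangle\otimes\mathbb{Q}\langle V\rangle$ given on words $c$ by $\Delta_I(c)=\sum_{u,w}(u\circledast w\mid c)\,u\otimes w$ (sum over all pairs of words) is the unique linear map satisfying $(A\circledast B\mid C)=(A\otimes B\mid\Delta_I(C))$ for all $A,B,C$. For endpoints $a,b$ (letters, or formal symbols declared to lie in $V_0$ or not) and $f\in\mathbb{Q}\langle V\rangle$ put $I(a;f;b)=f$ if $a\notin V_0$, $b\in V_0$; $I(a;f;b)=S(f)$ if $a\in V_0$, $b\notin V_0$; and $I(a;f;b)=(f\mid\mathbf 1)\mathbf 1$ if $a,b$ are both in $V_0$ or both not in $V_0$. **(2)** For all $n\ge0$ and $a_1,\dots,a_n\in V$, $$\Delta_I(a_1\cdots a_n)=\sum_{\substack{0\le k\le n\\ 0<j_1<\cdots<j_k\le n}}\Big(I(a_{j_0};a_{j_0+1}\cdots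 a_{j_1-1};a_{j_1})\,\star \cdots \star \,I(a_{j_k};a_{j_k+1}\cdots a_{j_{k+1}-1};a_{j_{k+1}})\Big)\otimes a_{j_1}\cdots a_{j_k},$$ where $j_0=0$, $j_{k+1}=n+1$, and one formally sets $a_0\in V\setminus V_0$ and $a_{n+1}\in V_0$. **(3)** For $V=\{v_0,v_1\}$ and $V_0=\{v_0\}$, $\Delta_I$ is Goncharov's coproduct, up to the order of the tensor factors. Precisely: call a family of linear maps $f\mapsto\mathbb I(a;f;b)$, $a,b\in V$, from $\mathbb{Q}\langle V\rangle$ to a $\mathbb Q$-vector space with a bilinear product and a distinguished element $e$ a Goncharov system if $\mathbb I(a;\mathbf 1;b)=e$; $\mathbb I(a;f;b)\,\mathbb I(a;g;b)=\mathbb I(a;f\,\star \,g;b)$; $\mathbb I(a;b_1\cdots b_m;b)=\sum_{i=0}^m\mathbb I(a;b_1\cdots b_i;x)\,\mathbb I(x;b_{i+1}\cdots b_m;b)$ for all $x\in V$; and $\mathbb I(a;w;a)=0$ for non-empty words $w$. Then the symbols $I(a;f;b)$ form a Goncharov system in $(\mathbb{Q}\langle V\rangle,\star )$ with $e=\mathbf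 1$, and this one is universal: for every Goncharov system $\mathbb I$ in a commutative $\mathbb{Q}$-algebra $R$ with $e=1$ there is a unique linear map $\varphi:\mathbb{Q}\langle V\rangle\to R$ with $\varphi(\mathbf 1)=1$, $\varphi(f\,\star \,g)=\varphi(f)\varphi(g)$ and $\varphi(I(a;f;b))=\mathbb I(a;f;b)$ for all $a,b,f,g$. Moreover, for all $n\ge0$, all $a_1,\dots,a_n\in V$ and all $a_0,a_{n+1}\in V$, $$\Delta_I\big(I(a_0;a_1\cdots a_n;a_{n+1})\big)=\sum_{\substack{0\le k\le n\\ 0<j_1<\cdots<j_k\le n}}\Big(I(a_{j_0};a_{j_0+1}\cdots a_{j_1-1};a_{j_1})\,\star \cdots \star \,I(a_{j_k};a_{j_k+1}\cdots a_{j_{k+1}-1};a_{j_{k+1}})\Big)\otimes I(a_0;a_{j_1}\cdots a_{j_k};a_{n+1}),$$ where again $j_0=0$ and $j_{k+1}=n+1$. -/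

import Mathlib

open scoped TensorProduct

noncomputable section

namespace Ihara

universe u

variable {V : Type u}

/-! ### The Hopf algebra `ℚ⟨V⟩` -/

/-- The word `a₁ ⋯ aₙ` as an element of `ℚ⟨V⟩`; the empty word is `1`. -/
def word (l : List V) : FreeAlgebra ℚ V := (l.map (FreeAlgebra.ι ℚ)).prod

/-- The shuffle coproduct: the algebra morphism with `Δ(v) = v ⊗ 1 + 1 ⊗ v` on letters. -/
def shuffleCoproduct : FreeAlgebra ℚ V →ₐ[ℚ] FreeAlgebra ℚ V ⊗[ℚ] FreeAlgebra ℚ V :=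
  FreeAlgebra.lift ℚ fun v => FreeAlgebra.ι ℚ v ⊗ₜ[ℚ] 1 + 1 ⊗ₜ[ℚ] FreeAlgebra.ι ℚ v

/-- The antipode: the anti-morphism of algebras with `S(v) = -v` on letters. -/
def antipode : FreeAlgebra ℚ V →ₗ[ℚ] FreeAlgebra ℚ V :=
  (MulOpposite.opLinearEquiv ℚ).symm.toLinearMap ∘ₗ
    (FreeAlgebra.lift ℚ fun v => MulOpposite.op (-FreeAlgebra.ι ℚ v) :
      FreeAlgebra ℚ V →ₐ[ℚ] (FreeAlgebra ℚ V)ᵐᵒᵖ).toLinearMap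

open Classical in
/-- The pairing `(- ∣ -)` on `ℚ⟨V⟩` for which the words are an orthonormal basis: `(A ∣ w)` is the
coefficient of the word `w` in `A`. -/
def pairing : FreeAlgebra ℚ V →ₗ[ℚ] FreeAlgebra ℚ V →ₗ[ℚ] ℚ :=
  (FreeAlgebra.basisFreeMonoid ℚ V).toDual

/-- `(A ⊗ B ∣ -)` on `ℚ⟨V⟩ ⊗ ℚ⟨V⟩`, with `(A ⊗ B ∣ C ⊗ D) = (A ∣ C) (B ∣ D)`. -/
def pairing₂ (A B : FreeAlgebra ℚ V) : FreeAlgebra ℚ V ⊗[ℚ] FreeAlgebra ℚ V →ₗ[ℚ] ℚ :=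
  LinearMap.mul' ℚ ℚ ∘ₗ TensorProduct.map (pairing A) (pairing B)

/-- The shuffle product of two words, by the usual recursion on first letters. -/
def shuffleWords : List V → List V → FreeAlgebra ℚ V
  | [], w => word w
  | u, [] => word u
  | x :: u, y :: w =>
      FreeAlgebra.ι ℚ x * shuffleWords u (y :: w) + FreeAlgebra.ι ℚ y * shuffleWords (x :: u) w
termination_by u w => u.length + w.length

/-- The shuffle product on `ℚ⟨V⟩`. -/
def shuffle : FreeAlgebra ℚ V →ₗ[ℚ] FreeAlgebra ℚ V →ₗ[ℚ] FreeAlgebra ℚ V :=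
  (FreeAlgebra.basisFreeMonoid ℚ V).constr ℚ fun u =>
    (FreeAlgebra.basisFreeMonoid ℚ V).constr ℚ fun w =>
      shuffleWords (FreeMonoid.toList u) (FreeMonoid.toList w)

/-- The shuffle product of a finite list of elements. -/
def shuffleProd (L : List (FreeAlgebra ℚ V)) : FreeAlgebra ℚ V :=
  L.foldr (fun A B => shuffle A B) 1

/-! ### The post-Lie product of the Ihara bracket and its extension to `ℚ⟨V⟩` -/

section Lie
attribute [local instance 100] LieRing.ofAssociativeRing

/-- The free Lie algebra `Lie(V)` inside its enveloping algebra `ℚ⟨V⟩`. -/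
def lieElements (V : Type u) : LieSubalgebra ℚ (FreeAlgebra ℚ V) :=
  LieSubalgebra.lieSpan ℚ (FreeAlgebra ℚ V) (Set.range (FreeAlgebra.ι ℚ))

/-- `T A B = A ▷ B` is the extended post-Lie product on `ℚ⟨V⟩ = U(Lie(V))` attached to `V₀ ⊆ V`.
The fields `letter_mem` and `letter_notMem` give `t ▷ v` for `t ∈ Lie(V)` and a letter `v`; by
`apply_mul` and `apply_one`, `t ▷ -` is a derivation, so they determine the post-Lie product on
`Lie(V)`. The remaining fields are the rules that extend a post-Lie product to the enveloping
algebra. -/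
structure IsIharaTriangle (V₀ : Set V)
    (T : FreeAlgebra ℚ V →ₗ[ℚ] FreeAlgebra ℚ V →ₗ[ℚ] FreeAlgebra ℚ V) : Prop where
  /-- `t ▷ v = 0` for `v ∈ V₀` -/
  letter_mem : ∀ t ∈ lieElements V, ∀ v ∈ V₀, T t (FreeAlgebra.ι ℚ v) = 0
  /-- `t ▷ v = [v, t]` for `v ∉ V₀` -/
  letter_notMem : ∀ t ∈ lieElements V, ∀ v ∉ V₀,
    T t (FreeAlgebra.ι ℚ v) = ⁅FreeAlgebra.ι ℚ v, t⁆
  /-- `A ▷ 1 = (A ∣ 1)`; in particular `x ▷ 1 = 0` for `x ∈ Lie(V)` -/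
  apply_one : ∀ A, T A 1 = algebraMap ℚ _ (pairing A 1)
  /-- `1 ▷ A = A` -/
  one_apply : ∀ A, T 1 A = A
  /-- `(x A) ▷ y = x ▷ (A ▷ y) - (x ▷ A) ▷ y` for `x, y ∈ Lie(V)` -/
  mul_apply : ∀ x ∈ lieElements V, ∀ y ∈ lieElements V, ∀ A,
    T (x * A) y = T x (T A y) - T (T x A) y
  /-- `A ▷ (B C) = (A₍₁₎ ▷ B) (A₍₂₎ ▷ C)` -/
  apply_mul : ∀ A B C, T A (B * C) =
    LinearMap.mul' ℚ _ (TensorProduct.map (T.flip B) (T.flip C) (shuffleCoproduct A))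

end Lie

/-! ### Existence and uniqueness of the extended post-Lie product -/

section Existence
attribute [local instance 100] LieRing.ofAssociativeRing

local notation "𝓐" => FreeAlgebra ℚ V
local notation "ιQ" => FreeAlgebra.ι ℚ

@[simp] theorem shuffleCoproduct_ι (v : V) :
    shuffleCoproduct (ιQ v) = ιQ v ⊗ₜ[ℚ] 1 + 1 ⊗ₜ[ℚ] ιQ v := by
  simp [shuffleCoproduct]

theorem antipode_mul (a b : 𝓐) : antipode (a * b) = antipode b * antipode a := by
  simp [antipode]

@[simp] theorem antipode_ι (v : V) : antipode (ιQ v) = -ιQ v := by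
  simp [antipode]

@[simp] theorem antipode_one : antipode (1 : 𝓐) = 1 := by
  simp [antipode]

theorem basis_eq_word (w : FreeMonoid V) :
    FreeAlgebra.basisFreeMonoid ℚ V w = word (FreeMonoid.toList w) := by
  simp [FreeAlgebra.basisFreeMonoid, FreeAlgebra.equivMonoidAlgebraFreeMonoid, word,
    FreeMonoid.lift_apply]

open Classical in
theorem pairing_one (A : 𝓐) : pairing A 1 = FreeAlgebra.algebraMapInv A := by
  have h1 : (1 : 𝓐) = FreeAlgebra.basisFreeMonoid ℚ V 1 := by
    rw [basis_eq_word]; simp [word]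
  suffices h : pairing.flip (1 : 𝓐) = FreeAlgebra.algebraMapInv.toLinearMap from
    LinearMap.congr_fun h A
  refine (FreeAlgebra.basisFreeMonoid ℚ V).ext fun w => ?_
  rw [LinearMap.flip_apply, h1, pairing, Module.Basis.toDual_apply, basis_eq_word]
  induction w using FreeMonoid.inductionOn' with
  | one => simp [word]
  | of_mul x w _ =>
    have : FreeMonoid.of x * w ≠ 1 := fun h => by
      have := congrArg FreeMonoid.length h
      simp at this
    simp [word, FreeAlgebra.algebraMapInv, this]

/-- The bialgebra `ℚ⟨V⟩` with the shuffle coproduct. -/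
@[reducible] def bialg : Bialgebra ℚ 𝓐 :=
  Bialgebra.ofAlgHom shuffleCoproduct FreeAlgebra.algebraMapInv
    (by
      ext v
      simp [TensorProduct.tmul_add, TensorProduct.add_tmul, add_assoc,
        Algebra.TensorProduct.one_def])
    (by ext v; simp [FreeAlgebra.algebraMapInv])
    (by ext v; simp [FreeAlgebra.algebraMapInv])

theorem isPrimitive {x : 𝓐} (hx : x ∈ lieElements V) :
    shuffleCoproduct x = x ⊗ₜ[ℚ] 1 + 1 ⊗ₜ[ℚ] x := by
  induction hx using LieSubalgebra.lieSpan_induction with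
  | mem x h => obtain ⟨v, rfl⟩ := h; simp
  | zero => simp
  | add x y _ _ hx hy =>
    rw [map_add, hx, hy, TensorProduct.add_tmul, TensorProduct.tmul_add]; abel
  | smul c x _ hx =>
    rw [map_smul, hx, smul_add, TensorProduct.smul_tmul', TensorProduct.tmul_smul]
  | lie x y _ _ hx hy =>
    simp only [Ring.lie_def, map_sub, map_mul, hx, hy, add_mul, mul_add,
      Algebra.TensorProduct.tmul_mul_tmul, one_mul, mul_one, TensorProduct.sub_tmul,
      TensorProduct.tmul_sub]
    abel

theorem antipode_lie {x : 𝓐} (hx : x ∈ lieElements V) : antipode x = -x := by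
  induction hx using LieSubalgebra.lieSpan_induction with
  | mem x h => obtain ⟨v, rfl⟩ := h; simp
  | zero => simp
  | add x y _ _ hx hy => rw [map_add, hx, hy]; abel
  | smul c x _ hx => rw [map_smul, hx, smul_neg]
  | lie x y _ _ hx hy =>
    simp only [Ring.lie_def, map_sub, antipode_mul, hx, hy]
    noncomm_ring

theorem counit_lie {x : 𝓐} (hx : x ∈ lieElements V) :
    FreeAlgebra.algebraMapInv x = 0 := by
  induction hx using LieSubalgebra.lieSpan_induction with
  | mem x h => obtain ⟨v, rfl⟩ := h; simp [FreeAlgebra.algebraMapInv]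
  | zero => simp
  | add x y _ _ hx hy => simp [hx, hy]
  | smul c x _ hx => simp [hx]
  | lie x y _ _ hx hy => simp [Ring.lie_def, hx, hy]

/-- `A ↦ S(A₍₁₎) v A₍₂₎`, precomposed with the coproduct -/
def conjAux (v : V) : 𝓐 ⊗[ℚ] 𝓐 →ₗ[ℚ] 𝓐 :=
  LinearMap.mul' ℚ _ ∘ₗ
    TensorProduct.map (LinearMap.mulRight ℚ (ιQ v) ∘ₗ antipode) LinearMap.id

@[simp] theorem conjAux_tmul (v : V) (a b : 𝓐) :
    conjAux v (a ⊗ₜ b) = antipode a * ιQ v * b := by simp [conjAux]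

open Classical in
/-- The action on a letter. -/
def letterAction (V₀ : Set V) (v : V) : 𝓐 →ₗ[ℚ] 𝓐 :=
  if v ∈ V₀ then FreeAlgebra.algebraMapInv.toLinearMap.smulRight (ιQ v)
  else conjAux v ∘ₗ shuffleCoproduct.toLinearMap

theorem exists_isIharaTriangle (V₀ : Set V) : ∃ T, IsIharaTriangle V₀ T := by
  let _ : Bialgebra ℚ 𝓐 := bialg
  let L : 𝓐 →ₐ[ℚ] WithConv (𝓐 →ₗ[ℚ] 𝓐) :=
    FreeAlgebra.lift ℚ fun v => WithConv.toConv (letterAction V₀ v)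
  let T : 𝓐 →ₗ[ℚ] 𝓐 →ₗ[ℚ] 𝓐 :=
    LinearMap.flip ((WithConv.linearEquiv ℚ (𝓐 →ₗ[ℚ] 𝓐)).toLinearMap ∘ₗ L.toLinearMap)
  have hT : ∀ A B, T A B = (L B).ofConv A := fun _ _ => rfl
  have hι : ∀ A v, T A (ιQ v) = letterAction V₀ v A := fun A v => by simp [hT, L]
  have hmul : ∀ A B C, T A (B * C) =
      LinearMap.mul' ℚ _ (TensorProduct.map (T.flip B) (T.flip C) (shuffleCoproduct A)) := by
    intro A B C
    rw [hT, map_mul]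
    rfl
  have hone : ∀ A, T A 1 = algebraMap ℚ _ (FreeAlgebra.algebraMapInv A) := by
    intro A; rw [hT, map_one]; rfl
  have hone' : ∀ B, T 1 B = B := by
    intro B
    induction B with
    | grade0 r => rw [Algebra.algebraMap_eq_smul_one, map_smul, hone]; simp
    | grade1 v => rw [hι]; by_cases hv : v ∈ V₀ <;>
        simp [letterAction, hv, Algebra.TensorProduct.one_def]
    | mul a b ha hb =>
      rw [hmul]; simp [Algebra.TensorProduct.one_def, ha, hb]
    | add a b ha hb => rw [map_add, ha, hb]
  have hlie : ∀ x ∈ lieElements V, ∀ B C, T x (B * C) = T x B * C + B * T x C := by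
    intro x hx B C
    rw [hmul, isPrimitive hx]; simp [hone']
  have hlie1 : ∀ x ∈ lieElements V, T x 1 = 0 := fun x hx => by
    rw [hone, counit_lie hx, map_zero]
  have hmem : ∀ x ∈ lieElements V, ∀ v ∈ V₀, T x (ιQ v) = 0 := by
    intro x hx v hv
    rw [hι]; simp [letterAction, hv, counit_lie hx]
  have hnmem : ∀ x ∈ lieElements V, ∀ v ∉ V₀, T x (ιQ v) = ιQ v * x - x * ιQ v := by
    intro x hx v hv
    rw [hι]; simp [letterAction, hv, isPrimitive hx, antipode_lie hx]; abel
  have halg : ∀ x ∈ lieElements V, ∀ r : ℚ, T x (algebraMap ℚ _ r) = 0 := by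
    intro x hx r
    rw [Algebra.algebraMap_eq_smul_one, map_smul, hlie1 x hx, smul_zero]
  have hcomm : ∀ x ∈ lieElements V, ∀ a, antipode (T x a) = T x (antipode a) := by
    intro x hx a
    induction a with
    | grade0 r =>
      rw [halg x hx, Algebra.algebraMap_eq_smul_one, map_smul, antipode_one, map_smul,
        hlie1 x hx]; simp
    | grade1 v =>
      by_cases hv : v ∈ V₀
      · simp [hmem x hx v hv]
      · rw [antipode_ι, map_neg, hnmem x hx v hv, map_sub, antipode_mul, antipode_mul,
          antipode_lie hx, antipode_ι]; noncomm_ring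
    | mul a b ha hb =>
      rw [hlie x hx, map_add, antipode_mul, antipode_mul, antipode_mul, hlie x hx, ha, hb]; abel
    | add a b ha hb => simp only [map_add, ha, hb]
  have hcoder : ∀ x ∈ lieElements V, ∀ a, shuffleCoproduct (T x a) =
      TensorProduct.map (T x) LinearMap.id (shuffleCoproduct a) +
      TensorProduct.map LinearMap.id (T x) (shuffleCoproduct a) := by
    intro x hx a
    induction a with
    | grade0 r =>
      rw [halg x hx, Algebra.algebraMap_eq_smul_one, map_smul, map_one,
        Algebra.TensorProduct.one_def]
      simp [hlie1 x hx]
    | grade1 v =>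
      by_cases hv : v ∈ V₀
      · simp [hmem x hx v hv, hlie1 x hx]
      · rw [hnmem x hx v hv]
        simp only [map_sub, map_mul, isPrimitive hx, shuffleCoproduct_ι, map_add,
          TensorProduct.map_tmul, hlie1 x hx, hnmem x hx v hv, add_mul, mul_add,
          Algebra.TensorProduct.tmul_mul_tmul, one_mul, mul_one, TensorProduct.sub_tmul,
          TensorProduct.tmul_sub, LinearMap.id_apply, TensorProduct.zero_tmul,
          TensorProduct.tmul_zero]
        abel
    | mul a b ha hb =>
      rw [hlie x hx, map_add, map_mul, map_mul, map_mul, ha, hb]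
      generalize shuffleCoproduct a = s
      generalize shuffleCoproduct b = t
      induction s with
      | zero => simp
      | add s s' hs hs' =>
        simp only [add_mul, map_add] at hs hs' ⊢
        have := congrArg₂ (· + ·) hs hs'; convert this using 1 <;> abel
      | tmul p q =>
        induction t with
        | zero => simp
        | add t t' hs hs' =>
          simp only [mul_add, map_add] at hs hs' ⊢
          have := congrArg₂ (· + ·) hs hs'; convert this using 1 <;> abel
        | tmul p' q' =>
          simp only [TensorProduct.map_tmul, Algebra.TensorProduct.tmul_mul_tmul, add_mul,
            mul_add, hlie x hx, TensorProduct.add_tmul, TensorProduct.tmul_add,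
            LinearMap.id_apply]
          abel
    | add a b ha hb => simp only [map_add, ha, hb]; abel
  refine ⟨T, hmem, hnmem, fun A => by rw [hone, pairing_one], hone', ?_, hmul⟩
  suffices H : ∀ x ∈ lieElements V, ∀ y A, T (x * A) y = T x (T A y) - T (T x A) y from
    fun x hx y _ A => H x hx y A
  intro x hx y A
  induction y generalizing A with
  | grade0 r =>
    rw [Algebra.algebraMap_eq_smul_one]
    simp only [map_smul, hone, map_mul, counit_lie hx, halg x hx]
    have : FreeAlgebra.algebraMapInv (T x A) = 0 := by
      induction A with
      | grade0 r => simp [halg x hx]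
      | grade1 v =>
        by_cases hv : v ∈ V₀
        · simp [hmem x hx v hv]
        · simp [hnmem x hx v hv, counit_lie hx]
      | mul a b ha hb => simp [hlie x hx, ha, hb]
      | add a b ha hb => simp [ha, hb]
    simp [this]
  | grade1 v =>
    simp only [hι]
    by_cases hv : v ∈ V₀
    · have : FreeAlgebra.algebraMapInv (T x A) = 0 := by
        induction A with
        | grade0 r => simp [halg x hx]
        | grade1 v =>
          by_cases hv : v ∈ V₀
          · simp [hmem x hx v hv]
          · simp [hnmem x hx v hv, counit_lie hx]
        | mul a b ha hb => simp [hlie x hx, ha, hb]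
        | add a b ha hb => simp [ha, hb]
      simp [letterAction, hv, counit_lie hx, hmem x hx v hv, this]
    · simp only [letterAction, hv, if_false, LinearMap.comp_apply, AlgHom.toLinearMap_apply,
        hcoder x hx, map_mul, isPrimitive hx]
      generalize shuffleCoproduct A = s
      induction s with
      | zero => simp
      | add s s' hs hs' =>
        simp only [mul_add, map_add] at hs hs' ⊢
        rw [hs, hs']; abel
      | tmul p q =>
        simp only [TensorProduct.map_tmul, Algebra.TensorProduct.tmul_mul_tmul, add_mul,
          map_add, conjAux_tmul, hlie x hx, antipode_mul, hcomm x hx, hnmem x hx v hv,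
          antipode_lie hx, LinearMap.id_apply, one_mul]
        noncomm_ring
  | mul b c hb hc =>
    simp only [hmul, hcoder x hx, map_mul, isPrimitive hx]
    generalize shuffleCoproduct A = s
    induction s with
    | zero => simp
    | add s s' hs hs' =>
      simp only [mul_add, map_add] at hs hs' ⊢
      rw [hs, hs']; abel
    | tmul p q =>
      simp only [TensorProduct.map_tmul, Algebra.TensorProduct.tmul_mul_tmul, add_mul,
        map_add, hlie x hx, LinearMap.id_apply, one_mul, LinearMap.flip_apply,
        LinearMap.mul'_apply, hb, hc]
      noncomm_ring
  | add b c hb hc => simp only [map_add, hb, hc]; abel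

/-- The rules determine the extended post-Lie product. -/
theorem IsIharaTriangle.unique {V₀ : Set V} {T T' : 𝓐 →ₗ[ℚ] 𝓐 →ₗ[ℚ] 𝓐}
    (h : IsIharaTriangle V₀ T) (h' : IsIharaTriangle V₀ T') : T = T' := by
  have hder : ∀ {S : 𝓐 →ₗ[ℚ] 𝓐 →ₗ[ℚ] 𝓐}, IsIharaTriangle V₀ S → ∀ x ∈ lieElements V, ∀ B C,
      S x (B * C) = S x B * C + B * S x C := by
    intro S hS x hx B C
    rw [hS.apply_mul, isPrimitive hx]; simp [hS.one_apply]
  have h1 : ∀ x ∈ lieElements V, ∀ B, T x B = T' x B := by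
    intro x hx B
    induction B with
    | grade0 r =>
      rw [Algebra.algebraMap_eq_smul_one, map_smul, map_smul, h.apply_one, h'.apply_one]
    | grade1 v =>
      by_cases hv : v ∈ V₀
      · rw [h.letter_mem x hx v hv, h'.letter_mem x hx v hv]
      · rw [h.letter_notMem x hx v hv, h'.letter_notMem x hx v hv]
    | mul a b ha hb => rw [hder h x hx, hder h' x hx, ha, hb]
    | add a b ha hb => rw [map_add, map_add, ha, hb]
  have hcl : ∀ x ∈ lieElements V, ∀ y ∈ lieElements V, T x y ∈ lieElements V := by
    intro x hx y hy
    induction hy using LieSubalgebra.lieSpan_induction with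
    | mem y hy =>
      obtain ⟨v, rfl⟩ := hy
      by_cases hv : v ∈ V₀
      · rw [h.letter_mem x hx v hv]; exact zero_mem _
      · rw [h.letter_notMem x hx v hv]
        exact LieSubalgebra.lie_mem _ (LieSubalgebra.subset_lieSpan ⟨v, rfl⟩) hx
    | zero => rw [map_zero]; exact zero_mem _
    | add a b _ _ ha hb => rw [map_add]; exact add_mem ha hb
    | smul c a _ ha => rw [map_smul]; exact LieSubalgebra.smul_mem _ _ ha
    | lie a b ha' hb' ha hb =>
      have : T x ⁅a, b⁆ = ⁅T x a, b⁆ + ⁅a, T x b⁆ := by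
        simp only [Ring.lie_def, map_sub, hder h x hx]; abel
      rw [this]
      exact add_mem (LieSubalgebra.lie_mem _ ha hb') (LieSubalgebra.lie_mem _ ha' hb)
  let W : ℕ → Submodule ℚ 𝓐 := fun n => Submodule.span ℚ
    {p | ∃ M : List 𝓐, M.length = n ∧ (∀ m ∈ M, m ∈ lieElements V) ∧ M.prod = p}
  have hW : ∀ x ∈ lieElements V, ∀ M : List 𝓐, (∀ m ∈ M, m ∈ lieElements V) →
      T x M.prod ∈ W M.length := by
    intro x hx M
    induction M with
    | nil =>
      intro _
      rw [List.prod_nil, h.apply_one, pairing_one, counit_lie hx, map_zero]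
      exact zero_mem _
    | cons m N ih =>
      intro hM
      have hm := hM m (by simp)
      have hN : ∀ n ∈ N, n ∈ lieElements V := fun n hn => hM n (by simp [hn])
      rw [List.prod_cons, hder h x hx]
      refine add_mem (Submodule.subset_span ⟨T x m :: N, by simp, ?_, by simp⟩) ?_
      · intro n hn
        rcases List.mem_cons.1 hn with rfl | hn
        · exact hcl x hx m hm
        · exact hN n hn
      · have : W N.length ≤ (W (m :: N).length).comap (LinearMap.mulLeft ℚ m) := by
          refine Submodule.span_le.2 ?_
          rintro _ ⟨P, hP, hP', rfl⟩
          refine Submodule.subset_span ⟨m :: P, by simp [hP], ?_, by simp⟩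
          intro n hn
          rcases List.mem_cons.1 hn with rfl | hn
          · exact hm
          · exact hP' n hn
        exact this (ih hN)
  have hQ : ∀ n, ∀ A ∈ W n, ∀ y ∈ lieElements V, T A y = T' A y := by
    intro n
    induction n with
    | zero =>
      intro A hA y _
      induction hA using Submodule.span_induction with
      | mem A hA =>
        obtain ⟨M, hM, _, rfl⟩ := hA
        rw [List.length_eq_zero_iff.1 hM, List.prod_nil, h.one_apply, h'.one_apply]
      | zero => simp
      | add a b _ _ ha hb => simp [ha, hb]
      | smul c a _ ha => simp [ha]
    | succ n ih =>
      intro A hA y hy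
      induction hA using Submodule.span_induction with
      | mem A hA =>
        obtain ⟨M, hM, hM', rfl⟩ := hA
        obtain ⟨x, N, rfl⟩ := List.exists_cons_of_length_eq_add_one hM
        have hx := hM' x (by simp)
        have hN : ∀ n ∈ N, n ∈ lieElements V := fun n hn => hM' n (by simp [hn])
        have hl : N.length = n := by simpa using hM
        have e1 := ih N.prod (Submodule.subset_span ⟨N, hl, hN, rfl⟩) y hy
        have e2 := ih _ (hl ▸ hW x hx N hN : T x N.prod ∈ W n) y hy
        rw [List.prod_cons, h.mul_apply x hx y hy, h'.mul_apply x hx y hy, ← h1 x hx N.prod,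
          ← e2, ← e1, h1 x hx (T N.prod y)]
      | zero => simp
      | add a b _ _ ha hb => simp [ha, hb]
      | smul c a _ ha => simp [ha]
  have hL : ∀ v, T.flip (ιQ v) = T'.flip (ιQ v) := by
    intro v
    refine (FreeAlgebra.basisFreeMonoid ℚ V).ext fun w => ?_
    rw [basis_eq_word]
    refine hQ (FreeMonoid.toList w).length _ (Submodule.subset_span
      ⟨(FreeMonoid.toList w).map (ιQ), by simp, ?_, rfl⟩) _
        (LieSubalgebra.subset_lieSpan ⟨v, rfl⟩)
    intro m hm
    obtain ⟨u, _, rfl⟩ := List.mem_map.1 hm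
    exact LieSubalgebra.subset_lieSpan ⟨u, rfl⟩
  have hF : ∀ B, T.flip B = T'.flip B := by
    intro B
    induction B with
    | grade0 r =>
      ext A
      simp only [LinearMap.flip_apply]
      rw [Algebra.algebraMap_eq_smul_one, map_smul, map_smul, h.apply_one, h'.apply_one]
    | grade1 v => exact hL v
    | mul a b ha hb =>
      ext A
      simp only [LinearMap.flip_apply]
      rw [h.apply_mul, h'.apply_mul, ha, hb]
    | add a b ha hb => rw [map_add, map_add, ha, hb]
  exact LinearMap.ext fun A => LinearMap.ext fun B => LinearMap.congr_fun (hF B) A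

end Existence

/-- The extended post-Lie product `▷_I` on `ℚ⟨V⟩`: the only map with `IsIharaTriangle V₀`. -/
def triangle (V₀ : Set V) : FreeAlgebra ℚ V →ₗ[ℚ] FreeAlgebra ℚ V →ₗ[ℚ] FreeAlgebra ℚ V :=
  (exists_isIharaTriangle V₀).choose

theorem isIharaTriangle_triangle (V₀ : Set V) : IsIharaTriangle V₀ (triangle V₀) :=
  (exists_isIharaTriangle V₀).choose_spec

/-! ### The Grossman-Larson product and its dual coproduct -/

/-- The Grossman-Larson product `A ⊛ B = A₍₁₎ (A₍₂₎ ▷ B)`. -/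
def grossmanLarson (V₀ : Set V) (A B : FreeAlgebra ℚ V) : FreeAlgebra ℚ V :=
  LinearMap.mul' ℚ _
    (TensorProduct.map LinearMap.id ((triangle V₀).flip B) (shuffleCoproduct A))

/-- The coproduct `Δ_I(c) = ∑ (u ⊛ w ∣ c) u ⊗ w`, summed over all pairs of words `u, w`. -/
def coproduct (V₀ : Set V) : FreeAlgebra ℚ V →ₗ[ℚ] FreeAlgebra ℚ V ⊗[ℚ] FreeAlgebra ℚ V :=
  (FreeAlgebra.basisFreeMonoid ℚ V).constr ℚ fun c =>
    ∑ᶠ p : List V × List V,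
      pairing (grossmanLarson V₀ (word p.1) (word p.2)) (word (FreeMonoid.toList c)) •
        (word p.1 ⊗ₜ[ℚ] word p.2)

/-! ### The symbols `I(a; f; b)` -/

open Classical in
/-- The symbol `I(a; f; b)`; it depends on the endpoints only through the truth values `p` of
`a ∈ V₀` and `q` of `b ∈ V₀`. -/
def symbol (p q : Prop) : FreeAlgebra ℚ V →ₗ[ℚ] FreeAlgebra ℚ V :=
  if ¬p ∧ q then LinearMap.id
  else if p ∧ ¬q then antipode
  else (pairing.flip 1).smulRight 1

/-- For letters `a₁, …, aₙ` (here `aᵢ = a (i - 1)`) and formal end letters `a₀`, `aₙ₊₁`, the truth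
value of `aᵢ ∈ V₀`, where `p` and `q` are those of `a₀ ∈ V₀` and `aₙ₊₁ ∈ V₀`. -/
def memAt (V₀ : Set V) (p q : Prop) {n : ℕ} (a : Fin n → V) (i : ℕ) : Prop :=
  if i = 0 then p else if h : i - 1 < n then a ⟨i - 1, h⟩ ∈ V₀ else q

/-- The word `aᵢ₊₁ ⋯ aⱼ₋₁`. -/
def segment {n : ℕ} (a : Fin n → V) (i j : ℕ) : FreeAlgebra ℚ V :=
  word (((List.ofFn a).take (j - 1)).drop i)

/-- For a set of positions `j₁ < ⋯ < jₖ` in `{1, …, n}` (the element `i` of `J` stands for the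
position `i + 1`), the position `jᵣ`, with `j₀ = 0` and `jₖ₊₁ = n + 1`. -/
def cut {n : ℕ} (J : Finset (Fin n)) (r : ℕ) : ℕ :=
  if r = 0 then 0
  else if h : r - 1 < J.card then (J.orderEmbOfFin rfl ⟨r - 1, h⟩ : ℕ) + 1
  else n + 1

/-- The shuffle product over `r = 0, …, k` of the `I(a_{jᵣ}; a_{jᵣ + 1} ⋯ a_{jᵣ₊₁ - 1}; a_{jᵣ₊₁})`. -/
def symbolProd (V₀ : Set V) (p q : Prop) {n : ℕ} (a : Fin n → V) (J : Finset (Fin n)) :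
    FreeAlgebra ℚ V :=
  shuffleProd ((List.range (J.card + 1)).map fun r =>
    symbol (memAt V₀ p q a (cut J r)) (memAt V₀ p q a (cut J (r + 1)))
      (segment a (cut J r) (cut J (r + 1))))

/-- The word `a_{j₁} ⋯ a_{jₖ}`. -/
def subword {n : ℕ} (a : Fin n → V) (J : Finset (Fin n)) : FreeAlgebra ℚ V :=
  word (List.ofFn fun i : Fin J.card => a (J.orderEmbOfFin rfl i))

/-- Goncharov's relations for symbols `𝕀(a; w; b)` with `a, b ∈ S` and `w` a word in `S` (extended
linearly in `w`), with values in a `ℚ`-vector space with product `m` and unit `e`. -/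
structure IsGoncharovSystem {S R : Type*} [AddCommGroup R] [Module ℚ R] (m : R →ₗ[ℚ] R →ₗ[ℚ] R)
    (e : R) (𝕀 : S → S → FreeAlgebra ℚ S →ₗ[ℚ] R) : Prop where
  unit : ∀ a b, 𝕀 a b 1 = e
  shuffle_mul : ∀ a b f g, m (𝕀 a b f) (𝕀 a b g) = 𝕀 a b (shuffle f g)
  path : ∀ a x b (w : List S), 𝕀 a b (word w) =
    ∑ i ∈ Finset.range (w.length + 1), m (𝕀 a x (word (w.take i))) (𝕀 x b (word (w.drop i)))
  loop : ∀ a (w : List S), w ≠ [] → 𝕀 a a (word w) = 0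

/-- The symbols for the alphabet `{v₀, v₁}` with `V₀ = {v₀}`. -/
def binarySymbol (s t : Fin 2) : FreeAlgebra ℚ (Fin 2) →ₗ[ℚ] FreeAlgebra ℚ (Fin 2) :=
  symbol (s ∈ ({0} : Set (Fin 2))) (t ∈ ({0} : Set (Fin 2)))

end Ihara

end

/-!
Everything rests on writing the Grossman-Larson product in the convolution algebra of endomorphisms
of the cocommutative bialgebra `ℚ⟨V⟩`. The rules for `▷` force `A ▷ v = (A ∣ 1) v` for `v ∈ V₀` and
`A ▷ v = S(A₍₁₎) v A₍₂₎` for `v ∉ V₀` (`IsIharaTriangle.apply_ι`), that is, `- ▷ v` is the convolution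
product `E⁻ * v * E⁺`, where `v` stands for `A ↦ (A ∣ 1) v` and `(E⁻, E⁺)` is `(1, 1)` if `v ∈ V₀` and
`(S, id)` otherwise. As `Δ` is an algebra morphism and `A ▷ (B C) = (A₍₁₎ ▷ B) (A₍₂₎ ▷ C)`,
`A ⊛ (b₁ ⋯ bₖ)` is the value at `A` of `id * E⁻ * b₁ * E⁺ * E⁻ * b₂ * ⋯ * bₖ * E⁺`
(`grossmanLarson_word`). Between two consecutive letters `a`, `b` stands `E⁺(a) * E⁻(b)`, which is one
of `id`, `S`, `id * S = 1`, `1 * 1 = 1`: exactly the symbol `I(a; -; b)` (`leftEnd_mul_rightEnd`).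

The formula for `Δ_I` is the transpose of this. Symbols are self-adjoint, shuffling is dual to `Δ`,
and concatenation is dual to deconcatenation, so the pairing of `A ⊛ (b₁ ⋯ bₖ)` with a word and the
sum over sets of positions satisfy the same recursion on the first letter `b₁`, which is the letter
at the first position (`pairing₂_cutSum`). Since the sum is an actual tensor, its coefficients are
those that define `Δ_I`.

For the symbols, path composition is `E⁺(a) * E⁻(b) = (E⁺(a) * E⁻(x)) * (E⁺(x) * E⁻(b))`, valid as
`E⁻(x) * E⁺(x) = 1`. Universality holds because a Goncharov system on `{v₀, v₁}` is determined by
`𝕀(v₁; -; v₀)`: loops are trivial, and `𝕀(v₀; -; v₁)` is a convolution inverse, hence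
`𝕀(v₁; S(-); v₀)`. The formula for the coproduct of a general symbol follows by applying `S`, which
reverses the convolution product above (`antipode_convProd`), or is immediate when both endpoints
are of the same kind.
-/

open scoped TensorProduct

noncomputable section

namespace Ihara

universe u

variable {V : Type u}

local notation "𝓐" => FreeAlgebra ℚ V
local notation "ιQ" => FreeAlgebra.ι ℚ

/-! ### Words and the pairing -/

@[simp] theorem word_nil : word ([] : List V) = 1 := by simp [word]

@[simp] theorem word_cons (x : V) (l : List V) : word (x :: l) = ιQ x * word l := by
  simp [word]

theorem word_append (l m : List V) : word (l ++ m) = word l * word m := by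
  simp [word]

/-- Linear maps out of `ℚ⟨V⟩` are determined by their values on words. -/
theorem linearMap_ext_word {M : Type*} [AddCommMonoid M] [Module ℚ M] {f g : 𝓐 →ₗ[ℚ] M}
    (h : ∀ l, f (word l) = g (word l)) : f = g := by
  refine (FreeAlgebra.basisFreeMonoid ℚ V).ext fun w => ?_
  rw [basis_eq_word]
  exact h _

theorem word_induction {p : 𝓐 → Prop} (word : ∀ l, p (word l)) (zero : p 0)
    (add : ∀ A B, p A → p B → p (A + B)) (smul : ∀ (r : ℚ) A, p A → p (r • A)) (A : 𝓐) : p A := by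
  rw [← (FreeAlgebra.basisFreeMonoid ℚ V).linearCombination_repr A,
    Finsupp.linearCombination_apply]
  refine Finset.sum_induction _ p (fun _ _ => add _ _) zero fun w _ => smul _ _ ?_
  rw [basis_eq_word]
  exact word _

theorem constr_word {M : Type*} [AddCommMonoid M] [Module ℚ M] (f : FreeMonoid V → M)
    (l : List V) :
    (FreeAlgebra.basisFreeMonoid ℚ V).constr ℚ f (word l) = f (FreeMonoid.ofList l) := by
  rw [← FreeMonoid.toList_ofList l, ← basis_eq_word, Module.Basis.constr_basis,
    FreeMonoid.toList_ofList]

open Classical in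
theorem pairing_word_word (l m : List V) :
    pairing (word l) (word m) = if l = m then 1 else 0 := by
  rw [← FreeMonoid.toList_ofList l, ← FreeMonoid.toList_ofList m, ← basis_eq_word,
    ← basis_eq_word, pairing, Module.Basis.toDual_apply]
  simp only [EmbeddingLike.apply_eq_iff_eq]

theorem pairing_comm (A B : 𝓐) : pairing A B = pairing B A := by
  have : (pairing : 𝓐 →ₗ[ℚ] 𝓐 →ₗ[ℚ] ℚ) = pairing.flip := by
    refine linearMap_ext_word fun l => linearMap_ext_word fun m => ?_
    classical
    rw [LinearMap.flip_apply, pairing_word_word, pairing_word_word]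
    simp only [eq_comm]
  rw [this, LinearMap.flip_apply, ← this]

theorem pairing_word (l : List V) (A : 𝓐) :
    pairing (word l) A =
      (FreeAlgebra.basisFreeMonoid ℚ V).repr A (FreeMonoid.ofList l) := by
  classical
  rw [pairing_comm, ← FreeMonoid.toList_ofList l, ← basis_eq_word, pairing,
    Module.Basis.toDual_eq_repr]
  simp

/-- The pairing is nondegenerate. -/
theorem ext_pairing {A B : 𝓐} (h : ∀ C, pairing C A = pairing C B) : A = B := by
  refine (FreeAlgebra.basisFreeMonoid ℚ V).ext_elem fun w => ?_
  rw [← FreeMonoid.ofList_toList w, ← pairing_word, ← pairing_word, h]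

open Classical in
theorem pairing_ι_mul_word_cons (x y : V) (A : 𝓐) (l : List V) :
    pairing (ιQ x * A) (word (y :: l)) = if x = y then pairing A (word l) else 0 := by
  have : pairing.flip (word (y :: l)) ∘ₗ LinearMap.mulLeft ℚ (ιQ x) =
      if x = y then pairing.flip (word l) else 0 := by
    refine linearMap_ext_word fun m => ?_
    rw [LinearMap.comp_apply, LinearMap.mulLeft_apply, ← word_cons, LinearMap.flip_apply,
      pairing_word_word]
    split_ifs with h h' h' <;> simp_all [pairing_word_word]
  have := LinearMap.congr_fun this A
  split_ifs at this ⊢ <;> simpa using this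

theorem pairing_ι_mul_one (x : V) (A : 𝓐) : pairing (ιQ x * A) 1 = 0 := by
  rw [pairing_one]; simp [FreeAlgebra.algebraMapInv]

/-- Concatenation is dual to deconcatenation of words. -/
theorem pairing_mul_word (A B : 𝓐) (c : List V) :
    pairing (A * B) (word c) = ∑ i ∈ Finset.range (c.length + 1),
      pairing A (word (c.take i)) * pairing B (word (c.drop i)) := by
  suffices h : (pairing.flip (word c)) ∘ₗ LinearMap.mulRight ℚ B =
      ∑ i ∈ Finset.range (c.length + 1),
        pairing B (word (c.drop i)) • pairing.flip (word (c.take i)) by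
    have := LinearMap.congr_fun h A
    simpa [mul_comm] using this
  refine linearMap_ext_word fun l => ?_
  simp only [LinearMap.comp_apply, LinearMap.mulRight_apply, LinearMap.flip_apply,
    LinearMap.sum_apply, LinearMap.smul_apply, smul_eq_mul]
  classical
  induction l generalizing c with
  | nil =>
    rw [Finset.sum_range_succ', Finset.sum_eq_zero]
    · simp [pairing_one]
    · intro i hi
      have hc : c ≠ [] := by rintro rfl; simp at hi
      rw [pairing_word_word, if_neg, mul_zero]
      simpa using hc.symm
  | cons x l ih =>
    rw [Finset.sum_range_succ']
    cases c with
    | nil => simp [mul_assoc, pairing_ι_mul_one]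
    | cons y c =>
      rw [word_cons, mul_assoc, pairing_ι_mul_word_cons]
      simp only [List.take_zero, List.drop_zero, List.take_succ_cons, List.drop_succ_cons,
        word_nil, pairing_ι_mul_one, mul_zero, add_zero, List.length_cons,
        pairing_ι_mul_word_cons]
      split_ifs with h
      · exact ih c
      · simp

@[simp] theorem pairing₂_tmul (A B C D : 𝓐) :
    pairing₂ A B (C ⊗ₜ D) = pairing A C * pairing B D := by
  simp [pairing₂]

theorem pairing₂_zero_left (B : 𝓐) (t) : pairing₂ 0 B t = 0 := by
  simp [pairing₂]

theorem pairing₂_zero_right (A : 𝓐) (t) : pairing₂ A 0 t = 0 := by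
  simp [pairing₂]

theorem pairing₂_add_left (A A' B : 𝓐) (t) :
    pairing₂ (A + A') B t = pairing₂ A B t + pairing₂ A' B t := by
  simp [pairing₂, TensorProduct.map_add_left]

theorem pairing₂_add_right (A B B' : 𝓐) (t) :
    pairing₂ A (B + B') t = pairing₂ A B t + pairing₂ A B' t := by
  simp [pairing₂, TensorProduct.map_add_right]

theorem pairing₂_smul_left (r : ℚ) (A B : 𝓐) (t) :
    pairing₂ (r • A) B t = r * pairing₂ A B t := by
  simp [pairing₂, TensorProduct.map_smul_left]

theorem pairing₂_smul_right (r : ℚ) (A B : 𝓐) (t) :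
    pairing₂ A (r • B) t = r * pairing₂ A B t := by
  simp [pairing₂, TensorProduct.map_smul_right]

theorem pairing₂_word (l m : List V) (t : 𝓐 ⊗[ℚ] 𝓐) :
    pairing₂ (word l) (word m) t =
      ((FreeAlgebra.basisFreeMonoid ℚ V).tensorProduct (FreeAlgebra.basisFreeMonoid ℚ V)).repr t
        (FreeMonoid.ofList l, FreeMonoid.ofList m) := by
  induction t with
  | zero => simp
  | add s t hs ht => simp [hs, ht]
  | tmul A B =>
    rw [pairing₂_tmul, pairing_word, pairing_word, Module.Basis.tensorProduct_repr_tmul_apply,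
      smul_eq_mul, mul_comm]

theorem ext_pairing₂ {s t : 𝓐 ⊗[ℚ] 𝓐}
    (h : ∀ l m, pairing₂ (word l) (word m) s = pairing₂ (word l) (word m) t) : s = t := by
  refine ((FreeAlgebra.basisFreeMonoid ℚ V).tensorProduct
    (FreeAlgebra.basisFreeMonoid ℚ V)).ext_elem fun p => ?_
  have := h (FreeMonoid.toList p.1) (FreeMonoid.toList p.2)
  rwa [pairing₂_word, pairing₂_word] at this

/-- The expansion of a tensor in the basis of pairs of words. -/
theorem finsum_pairing₂ (t : 𝓐 ⊗[ℚ] 𝓐) :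
    ∑ᶠ p : List V × List V, pairing₂ (word p.1) (word p.2) t • (word p.1 ⊗ₜ[ℚ] word p.2) = t := by
  let b := (FreeAlgebra.basisFreeMonoid ℚ V).tensorProduct (FreeAlgebra.basisFreeMonoid ℚ V)
  have hb : ∀ p : List V × List V, b (FreeMonoid.ofList p.1, FreeMonoid.ofList p.2) =
      word p.1 ⊗ₜ[ℚ] word p.2 := fun p => by
    simp [b, Module.Basis.tensorProduct_apply, basis_eq_word]
  have key : ∑ᶠ p : FreeMonoid V × FreeMonoid V, b.repr t p • b p = t := by
    conv_rhs => rw [← b.linearCombination_repr t, Finsupp.linearCombination_apply, Finsupp.sum]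
    refine finsum_eq_sum_of_support_subset _ fun p hp => ?_
    simp only [Function.mem_support] at hp
    simp only [Finset.mem_coe, Finsupp.mem_support_iff]
    rintro h
    simp [h] at hp
  conv_rhs => rw [← key]
  refine finsum_eq_of_bijective (fun p => (FreeMonoid.ofList p.1, FreeMonoid.ofList p.2))
    (FreeMonoid.ofList.bijective.prodMap FreeMonoid.ofList.bijective) fun p => ?_
  rw [hb, pairing₂_word]

/-! ### The shuffle product and the antipode -/

@[simp] theorem shuffleWords_nil_left (w : List V) : shuffleWords [] w = word w := by
  rw [shuffleWords]

@[simp] theorem shuffleWords_nil_right (u : List V) : shuffleWords u [] = word u := by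
  cases u <;> simp [shuffleWords]

theorem shuffle_word_word (u w : List V) : shuffle (word u) (word w) = shuffleWords u w := by
  rw [shuffle, constr_word, constr_word]; simp

@[simp] theorem shuffle_one_left (A : 𝓐) : shuffle 1 A = A := by
  have : shuffle (1 : 𝓐) = LinearMap.id := linearMap_ext_word fun l => by
    rw [← word_nil, shuffle_word_word]; simp
  rw [this, LinearMap.id_apply]

@[simp] theorem shuffle_one_right (A : 𝓐) : shuffle A 1 = A := by
  have : shuffle.flip (1 : 𝓐) = LinearMap.id := linearMap_ext_word fun l => by
    rw [LinearMap.flip_apply, ← word_nil, shuffle_word_word]; simp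
  rw [← LinearMap.flip_apply, this, LinearMap.id_apply]

theorem pairing₂_ι_tmul_one_mul_cons (x y : V) (u : List V) (g : 𝓐) (t : 𝓐 ⊗[ℚ] 𝓐)
    [Decidable (x = y)] :
    pairing₂ (word (y :: u)) g (ιQ x ⊗ₜ 1 * t) = if x = y then pairing₂ (word u) g t else 0 := by
  induction t with
  | zero => simp
  | add s t hs ht => rw [mul_add, map_add, hs, ht, map_add]; split_ifs <;> simp
  | tmul A B =>
    rw [Algebra.TensorProduct.tmul_mul_tmul, pairing₂_tmul, pairing_comm (word _),
      pairing_ι_mul_word_cons, one_mul, pairing₂_tmul, pairing_comm A]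
    split_ifs <;> simp

theorem pairing₂_one_ι_tmul_one_mul (x : V) (g : 𝓐) (t : 𝓐 ⊗[ℚ] 𝓐) :
    pairing₂ 1 g (ιQ x ⊗ₜ 1 * t) = 0 := by
  induction t with
  | zero => simp
  | add s t hs ht => rw [mul_add, map_add, hs, ht, add_zero]
  | tmul A B =>
    rw [Algebra.TensorProduct.tmul_mul_tmul, pairing₂_tmul, pairing_comm 1, pairing_ι_mul_one,
      zero_mul]

theorem pairing₂_one_tmul_ι_mul_cons (x y : V) (u : List V) (g : 𝓐) (t : 𝓐 ⊗[ℚ] 𝓐)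
    [Decidable (x = y)] :
    pairing₂ g (word (y :: u)) (1 ⊗ₜ ιQ x * t) = if x = y then pairing₂ g (word u) t else 0 := by
  induction t with
  | zero => simp
  | add s t hs ht => rw [mul_add, map_add, hs, ht, map_add]; split_ifs <;> simp
  | tmul A B =>
    rw [Algebra.TensorProduct.tmul_mul_tmul, pairing₂_tmul, pairing_comm (word _),
      pairing_ι_mul_word_cons, one_mul, pairing₂_tmul, pairing_comm B]
    split_ifs <;> simp

theorem pairing₂_one_one_tmul_ι_mul (x : V) (g : 𝓐) (t : 𝓐 ⊗[ℚ] 𝓐) :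
    pairing₂ g 1 (1 ⊗ₜ ιQ x * t) = 0 := by
  induction t with
  | zero => simp
  | add s t hs ht => rw [mul_add, map_add, hs, ht, add_zero]
  | tmul A B =>
    rw [Algebra.TensorProduct.tmul_mul_tmul, pairing₂_tmul, pairing_comm 1, pairing_ι_mul_one,
      mul_zero]

theorem pairing_word_shuffleWords (c u w : List V) :
    pairing (word c) (shuffleWords u w) =
      pairing₂ (word u) (word w) (shuffleCoproduct (word c)) := by
  classical
  induction c generalizing u w with
  | nil =>
    rw [word_nil, map_one shuffleCoproduct, Algebra.TensorProduct.one_def, pairing₂_tmul,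
      pairing_comm]
    cases u with
    | nil => simp [pairing_one]
    | cons x u =>
      cases w with
      | nil => simp [pairing_one]
      | cons y w => simp [shuffleWords, pairing_one, FreeAlgebra.algebraMapInv]
  | cons z c ih =>
    rw [word_cons, map_mul shuffleCoproduct, shuffleCoproduct_ι, add_mul, map_add, ← word_cons]
    cases u with
    | nil =>
      rw [word_nil, pairing₂_one_ι_tmul_one_mul, zero_add, shuffleWords_nil_left]
      cases w with
      | nil =>
        rw [word_nil, pairing₂_one_one_tmul_ι_mul, word_cons, pairing_ι_mul_one]
      | cons y w =>
        rw [pairing₂_one_tmul_ι_mul_cons, word_cons z, pairing_ι_mul_word_cons]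
        have := ih [] w
        simp only [shuffleWords_nil_left, word_nil] at this
        rw [this]
    | cons x u =>
      rw [pairing₂_ι_tmul_one_mul_cons]
      cases w with
      | nil =>
        rw [word_nil, pairing₂_one_one_tmul_ι_mul, shuffleWords_nil_right, word_cons z,
          pairing_ι_mul_word_cons, add_zero]
        have := ih u []
        simp only [shuffleWords_nil_right, word_nil] at this
        rw [this]
      | cons y w =>
        rw [pairing₂_one_tmul_ι_mul_cons, ← ih, ← ih, shuffleWords, map_add,
          pairing_comm, pairing_comm _ (ιQ y * _), word_cons, ← word_cons,
          pairing_ι_mul_word_cons, pairing_ι_mul_word_cons, pairing_comm _ (word c),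
          pairing_comm _ (word c)]
        simp only [eq_comm]

/-- The shuffle product is dual to the shuffle coproduct. -/
theorem pairing_shuffle (A f g : 𝓐) :
    pairing A (shuffle f g) = pairing₂ f g (shuffleCoproduct A) := by
  induction f using word_induction with
  | zero => simp [pairing₂_zero_left]
  | add f f' h h' => simp [pairing₂_add_left, h, h']
  | smul r f h => simp [pairing₂_smul_left, h]
  | word u =>
    induction g using word_induction with
    | zero => simp [pairing₂_zero_right]
    | add f f' h h' => simp [pairing₂_add_right, h, h']
    | smul r f h => simp [pairing₂_smul_right, h]
    | word w =>
      induction A using word_induction with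
      | zero => simp
      | add f f' h h' => simp [h, h']
      | smul r f h => simp [h]
      | word c => rw [shuffle_word_word, pairing_word_shuffleWords]

theorem antipode_word (l : List V) :
    antipode (word l) = (-1 : ℚ) ^ l.length • word l.reverse := by
  induction l with
  | nil => simp
  | cons x l ih =>
    rw [word_cons, antipode_mul, ih, antipode_ι, List.reverse_cons, word_append]
    simp [pow_succ]

theorem antipode_antipode (A : 𝓐) : antipode (antipode A) = A := by
  have : antipode ∘ₗ antipode = (LinearMap.id : 𝓐 →ₗ[ℚ] 𝓐) := linearMap_ext_word fun l => by
    simp [antipode_word, smul_smul, ← mul_pow]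
  exact LinearMap.congr_fun this A

/-- The antipode is self-adjoint. -/
theorem pairing_antipode (A B : 𝓐) : pairing (antipode A) B = pairing A (antipode B) := by
  have : pairing ∘ₗ antipode = (pairing : 𝓐 →ₗ[ℚ] 𝓐 →ₗ[ℚ] ℚ).compl₂ antipode := by
    refine linearMap_ext_word fun l => linearMap_ext_word fun m => ?_
    classical
    simp only [LinearMap.comp_apply, LinearMap.compl₂_apply, antipode_word, map_smul,
      LinearMap.smul_apply, pairing_word_word, List.reverse_eq_iff]
    split_ifs with h
    · simp [h]
    · simp
  exact LinearMap.congr_fun (LinearMap.congr_fun this A) B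

theorem shuffleCoproduct_antipode (A : 𝓐) :
    shuffleCoproduct (antipode A) = TensorProduct.map antipode antipode (shuffleCoproduct A) := by
  have hanti : ∀ s t : 𝓐 ⊗[ℚ] 𝓐, TensorProduct.map antipode antipode (s * t) =
      TensorProduct.map antipode antipode t * TensorProduct.map antipode antipode s := by
    intro s t
    induction s with
    | zero => simp
    | add s s' h h' => simp only [add_mul, map_add, h, h', mul_add]
    | tmul a b =>
      induction t with
      | zero => simp
      | add s s' h h' => simp only [add_mul, map_add, h, h', mul_add]
      | tmul c d => simp [antipode_mul]
  induction A with
  | grade0 r => simp [Algebra.algebraMap_eq_smul_one, Algebra.TensorProduct.one_def]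
  | grade1 v => simp [TensorProduct.neg_tmul, TensorProduct.tmul_neg, add_comm]
  | mul a b ha hb => rw [antipode_mul, map_mul, ha, hb, map_mul, hanti]
  | add a b ha hb => simp only [map_add, ha, hb]

theorem comm_shuffleCoproduct (A : 𝓐) :
    TensorProduct.comm ℚ 𝓐 𝓐 (shuffleCoproduct A) = shuffleCoproduct A := by
  have : (Algebra.TensorProduct.comm ℚ 𝓐 𝓐).toAlgHom.comp shuffleCoproduct =
      shuffleCoproduct := by
    ext v; simp [add_comm]
  exact DFunLike.congr_fun this A

theorem antipode_shuffle (f g : 𝓐) :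
    antipode (shuffle f g) = shuffle (antipode f) (antipode g) := by
  refine ext_pairing fun C => ?_
  rw [← pairing_antipode, pairing_shuffle, pairing_shuffle, shuffleCoproduct_antipode]
  generalize shuffleCoproduct C = t
  induction t with
  | zero => simp
  | add s t hs ht => simp only [map_add, hs, ht]
  | tmul A B => simp [pairing_antipode]

theorem counit_shuffle (f g : 𝓐) : pairing (shuffle f g) 1 = pairing f 1 * pairing g 1 := by
  rw [pairing_comm, pairing_shuffle, map_one shuffleCoproduct, Algebra.TensorProduct.one_def,
    pairing₂_tmul]

/-! ### The convolution algebra of `ℚ⟨V⟩` -/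

section Convolution
attribute [local instance] bialg

theorem comul_eq (A : 𝓐) : CoalgebraStruct.comul (R := ℚ) A = shuffleCoproduct A := rfl

theorem counit_eq (A : 𝓐) : CoalgebraStruct.counit (R := ℚ) A = FreeAlgebra.algebraMapInv A := rfl

/-- The identity, as an element of the convolution algebra. -/
def convId : WithConv (𝓐 →ₗ[ℚ] 𝓐) := WithConv.toConv LinearMap.id

/-- The antipode, as an element of the convolution algebra. -/
def convAntipode : WithConv (𝓐 →ₗ[ℚ] 𝓐) := WithConv.toConv antipode

/-- The map `A ↦ (A ∣ 1) v`, as an element of the convolution algebra. -/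
def convLetter (v : V) : WithConv (𝓐 →ₗ[ℚ] 𝓐) :=
  WithConv.toConv (FreeAlgebra.algebraMapInv.toLinearMap.smulRight (ιQ v))

theorem conv_mul_apply (f g : WithConv (𝓐 →ₗ[ℚ] 𝓐)) (A : 𝓐) :
    (f * g).ofConv A =
      LinearMap.mul' ℚ 𝓐 (TensorProduct.map f.ofConv g.ofConv (shuffleCoproduct A)) := rfl

theorem conv_one_apply (A : 𝓐) : (1 : WithConv (𝓐 →ₗ[ℚ] 𝓐)).ofConv A = pairing A 1 • 1 := by
  rw [pairing_one, ← Algebra.algebraMap_eq_smul_one]; rfl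

theorem convLetter_mul_apply (v : V) (f : WithConv (𝓐 →ₗ[ℚ] 𝓐)) (A : 𝓐) :
    (convLetter v * f).ofConv A = ιQ v * f.ofConv A := by
  have h := Coalgebra.rTensor_counit_comul (R := ℚ) A
  rw [comul_eq] at h
  have h2 : ∀ t : 𝓐 ⊗[ℚ] 𝓐, TensorProduct.map (convLetter v).ofConv f.ofConv t =
      TensorProduct.map ((LinearMap.id : ℚ →ₗ[ℚ] ℚ).smulRight (ιQ v)) f.ofConv
        (LinearMap.rTensor 𝓐 (CoalgebraStruct.counit (R := ℚ)) t) := by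
    intro t
    induction t with
    | zero => simp
    | add s t hs ht => simp only [map_add, hs, ht]
    | tmul B C => simp [convLetter, counit_eq]
  rw [conv_mul_apply, h2, h]; simp

theorem mul_convLetter_apply (v : V) (f : WithConv (𝓐 →ₗ[ℚ] 𝓐)) (A : 𝓐) :
    (f * convLetter v).ofConv A = f.ofConv A * ιQ v := by
  have h := Coalgebra.lTensor_counit_comul (R := ℚ) A
  rw [comul_eq] at h
  have h2 : ∀ t : 𝓐 ⊗[ℚ] 𝓐, TensorProduct.map f.ofConv (convLetter v).ofConv t =
      TensorProduct.map f.ofConv ((LinearMap.id : ℚ →ₗ[ℚ] ℚ).smulRight (ιQ v))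
        (LinearMap.lTensor 𝓐 (CoalgebraStruct.counit (R := ℚ)) t) := by
    intro t
    induction t with
    | zero => simp
    | add s t hs ht => simp only [map_add, hs, ht]
    | tmul B C => simp [convLetter, counit_eq]
  rw [conv_mul_apply, h2, h]; simp

theorem conv_mul_one_apply (f g : WithConv (𝓐 →ₗ[ℚ] 𝓐)) :
    (f * g).ofConv 1 = f.ofConv 1 * g.ofConv 1 := by
  rw [conv_mul_apply, map_one, Algebra.TensorProduct.one_def]; simp

theorem convId_mul_convAntipode : (convId * convAntipode : WithConv (𝓐 →ₗ[ℚ] 𝓐)) = 1 := by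
  refine WithConv.ofConv_injective (linearMap_ext_word fun l => ?_)
  induction l with
  | nil => rw [word_nil, conv_mul_one_apply]; simp [convId, convAntipode]
  | cons x l ih =>
    have key : ∀ t : 𝓐 ⊗[ℚ] 𝓐, LinearMap.mul' ℚ 𝓐 (TensorProduct.map LinearMap.id antipode
        ((ιQ x ⊗ₜ 1 + 1 ⊗ₜ ιQ x) * t)) =
        ιQ x * LinearMap.mul' ℚ 𝓐 (TensorProduct.map LinearMap.id antipode t) -
        LinearMap.mul' ℚ 𝓐 (TensorProduct.map LinearMap.id antipode t) * ιQ x := by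
      intro t
      induction t with
      | zero => simp
      | add s t hs ht => rw [mul_add]; simp only [map_add, hs, ht]; noncomm_ring
      | tmul B C => simp [add_mul, antipode_mul, mul_assoc, sub_eq_add_neg]
    rw [conv_mul_apply, conv_one_apply] at ih ⊢
    simp only [convId, convAntipode] at ih ⊢
    rw [word_cons, map_mul, shuffleCoproduct_ι, key, ih, pairing_ι_mul_one]
    simp

theorem convAntipode_mul_convId : (convAntipode * convId : WithConv (𝓐 →ₗ[ℚ] 𝓐)) = 1 := by
  refine WithConv.ofConv_injective (linearMap_ext_word fun l => ?_)
  induction l with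
  | nil => rw [word_nil, conv_mul_one_apply]; simp [convId, convAntipode]
  | cons x l ih =>
    have key : ∀ t : 𝓐 ⊗[ℚ] 𝓐, LinearMap.mul' ℚ 𝓐 (TensorProduct.map antipode LinearMap.id
        ((ιQ x ⊗ₜ 1 + 1 ⊗ₜ ιQ x) * t)) = 0 := by
      intro t
      induction t with
      | zero => simp
      | add s t hs ht => rw [mul_add]; simp only [map_add, hs, ht, add_zero]
      | tmul B C => simp [add_mul, antipode_mul, mul_assoc]
    rw [conv_mul_apply, conv_one_apply] at ⊢
    simp only [convId, convAntipode] at ⊢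
    rw [word_cons, map_mul, shuffleCoproduct_ι, key, pairing_ι_mul_one]
    simp

/-- `ℚ⟨V⟩` being cocommutative, `f ↦ S ∘ f` is an anti-morphism of the convolution algebra. -/
theorem antipode_comp_conv_mul (f g : WithConv (𝓐 →ₗ[ℚ] 𝓐)) :
    WithConv.toConv (antipode ∘ₗ (f * g).ofConv) =
      WithConv.toConv (antipode ∘ₗ g.ofConv) * WithConv.toConv (antipode ∘ₗ f.ofConv) := by
  refine WithConv.ofConv_injective (LinearMap.ext fun A => ?_)
  rw [conv_mul_apply, ← comm_shuffleCoproduct A]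
  simp only [LinearMap.comp_apply, conv_mul_apply]
  generalize shuffleCoproduct A = t
  induction t with
  | zero => simp
  | add s t hs ht => simp only [map_add, hs, ht]
  | tmul B C => simp [antipode_mul]

open Classical in
/-- The factor `E⁺` that the left endpoint of a symbol contributes: `1` if it lies in `V₀`, and `id`
otherwise. -/
def leftEnd (p : Prop) : WithConv (𝓐 →ₗ[ℚ] 𝓐) := if p then 1 else convId

open Classical in
/-- The factor `E⁻` that the right endpoint of a symbol contributes: `1` if it lies in `V₀`, and `S`
otherwise. -/
def rightEnd (q : Prop) : WithConv (𝓐 →ₗ[ℚ] 𝓐) := if q then 1 else convAntipode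

/-- A symbol is the convolution product of contributions of its two endpoints. -/
theorem leftEnd_mul_rightEnd (p q : Prop) :
    (leftEnd p * rightEnd q : WithConv (𝓐 →ₗ[ℚ] 𝓐)) = WithConv.toConv (symbol p q) := by
  have h1 : (1 : WithConv (𝓐 →ₗ[ℚ] 𝓐)) = WithConv.toConv ((pairing.flip 1).smulRight 1) :=
    WithConv.ofConv_injective (LinearMap.ext fun A => conv_one_apply A)
  by_cases hp : p <;> by_cases hq : q <;>
    simp [leftEnd, rightEnd, symbol, hp, hq, convId_mul_convAntipode, ← h1]
  · rfl
  · rfl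

/-- The action `A ↦ A ▷ v` on a letter, as a convolution product `E⁻ * v * E⁺`. -/
def convAction (V₀ : Set V) (v : V) : WithConv (𝓐 →ₗ[ℚ] 𝓐) :=
  rightEnd (v ∈ V₀) * convLetter v * leftEnd (v ∈ V₀)

theorem convAction_apply (V₀ : Set V) (v : V) (A : 𝓐) :
    (convAction V₀ v).ofConv A = letterAction V₀ v A := by
  by_cases hv : v ∈ V₀
  · simp only [convAction, letterAction, hv, rightEnd, leftEnd, if_true, one_mul, mul_one]
    rfl
  · simp only [convAction, letterAction, hv, rightEnd, leftEnd, if_false]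
    rw [conv_mul_apply]
    simp only [LinearMap.comp_apply, conjAux]
    have h : (convAntipode * convLetter v).ofConv =
        LinearMap.mulRight ℚ (ιQ v) ∘ₗ antipode := LinearMap.ext fun B => by
      rw [mul_convLetter_apply]; rfl
    rw [h]; rfl

theorem antipode_comp_convAction (V₀ : Set V) (v : V) :
    WithConv.toConv (antipode ∘ₗ (convAction V₀ v).ofConv) = (-1 : ℚ) • convAction V₀ v := by
  have h1 : WithConv.toConv (antipode ∘ₗ (convLetter v).ofConv) = (-1 : ℚ) • convLetter v :=
    WithConv.ofConv_injective (LinearMap.ext fun A => by simp [convLetter])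
  have h2 : WithConv.toConv (antipode ∘ₗ (convAntipode (V := V)).ofConv) = convId :=
    WithConv.ofConv_injective (LinearMap.ext fun A => antipode_antipode A)
  have h3 : WithConv.toConv (antipode ∘ₗ (convId (V := V)).ofConv) = convAntipode := rfl
  by_cases hv : v ∈ V₀
  · simp [convAction, hv, rightEnd, leftEnd, h1]
  · simp only [convAction, hv, rightEnd, leftEnd, if_false, antipode_comp_conv_mul, h1, h2, h3]
    rw [smul_mul_assoc, mul_smul_comm, mul_assoc]

/-- The convolution product of the actions on the letters of `l`, with a left endpoint of kind `p` and
a right endpoint of kind `q`. For `p` false and `q` true, it is `A ↦ A₍₁₎ (A₍₂₎ ▷ l) = A ⊛ l`. -/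
def convProd (V₀ : Set V) (p q : Prop) (l : List V) : WithConv (𝓐 →ₗ[ℚ] 𝓐) :=
  leftEnd p * (l.map (convAction V₀)).prod * rightEnd q

theorem convProd_nil (V₀ : Set V) (p q : Prop) :
    convProd V₀ p q [] = WithConv.toConv (symbol p q) := by
  simp [convProd, leftEnd_mul_rightEnd]

theorem convProd_cons (V₀ : Set V) (p q : Prop) (b : V) (l : List V) :
    convProd V₀ p q (b :: l) =
      WithConv.toConv (symbol p (b ∈ V₀)) * (convLetter b * convProd V₀ (b ∈ V₀) q l) := by
  simp [convProd, ← leftEnd_mul_rightEnd, convAction, mul_assoc]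

theorem antipode_comp_prod_convAction (V₀ : Set V) (l : List V) :
    WithConv.toConv (antipode ∘ₗ ((l.map (convAction V₀)).prod).ofConv) =
      (-1 : ℚ) ^ l.length • (l.reverse.map (convAction V₀)).prod := by
  induction l with
  | nil =>
    refine WithConv.ofConv_injective (LinearMap.ext fun A => ?_)
    rw [List.map_nil, List.prod_nil, LinearMap.comp_apply, conv_one_apply, List.length_nil,
      pow_zero, one_smul, List.reverse_nil, List.map_nil, List.prod_nil, conv_one_apply, map_smul,
      antipode_one]
  | cons b l ih =>
    rw [List.map_cons, List.prod_cons, antipode_comp_conv_mul, ih, antipode_comp_convAction,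
      smul_mul_assoc, mul_smul_comm, smul_smul, List.length_cons, pow_succ, List.reverse_cons,
      List.map_append, List.prod_append, List.map_singleton, List.prod_singleton]

/-- The antipode reverses the convolution product, and exchanges `id` and `S`. -/
theorem antipode_convProd (V₀ : Set V) (l : List V) (A : 𝓐) :
    antipode ((convProd V₀ False True l).ofConv A) =
      (-1 : ℚ) ^ l.length • (convProd V₀ True False l.reverse).ofConv A := by
  have h3 : WithConv.toConv (antipode ∘ₗ (convId (V := V)).ofConv) = convAntipode := rfl
  have : WithConv.toConv (antipode ∘ₗ (convProd V₀ False True l).ofConv) =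
      (-1 : ℚ) ^ l.length • convProd V₀ True False l.reverse := by
    simp only [convProd, leftEnd, rightEnd, if_true, if_false, mul_one, one_mul,
      antipode_comp_conv_mul, antipode_comp_prod_convAction, h3]
    rw [smul_mul_assoc]
  exact congrArg (fun f => f.ofConv A) this

end Convolution

/-! ### The Grossman-Larson product as a convolution product -/

section Lie
attribute [local instance 100] LieRing.ofAssociativeRing

namespace IsIharaTriangle

variable {V₀ : Set V} 
  {T : FreeAlgebra ℚ V →ₗ[ℚ] FreeAlgebra ℚ V →ₗ[ℚ] FreeAlgebra ℚ V}

theorem apply_one_of_mem (h : IsIharaTriangle V₀ T) {x : 𝓐} (hx : x ∈ lieElements V) :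
    T x 1 = 0 := by
  rw [h.apply_one, pairing_one, counit_lie hx, map_zero]

theorem apply_algebraMap_of_mem (h : IsIharaTriangle V₀ T) {x : 𝓐} (hx : x ∈ lieElements V)
    (r : ℚ) : T x (algebraMap ℚ _ r) = 0 := by
  rw [Algebra.algebraMap_eq_smul_one, map_smul, h.apply_one_of_mem hx, smul_zero]

theorem derivation (h : IsIharaTriangle V₀ T) {x : 𝓐} (hx : x ∈ lieElements V) (B C : 𝓐) :
    T x (B * C) = T x B * C + B * T x C := by
  rw [h.apply_mul, isPrimitive hx]; simp [h.one_apply]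

theorem apply_mem (h : IsIharaTriangle V₀ T) {x y : 𝓐} (hx : x ∈ lieElements V)
    (hy : y ∈ lieElements V) : T x y ∈ lieElements V := by
  induction hy using LieSubalgebra.lieSpan_induction with
  | mem y hy =>
    obtain ⟨v, rfl⟩ := hy
    by_cases hv : v ∈ V₀
    · rw [h.letter_mem x hx v hv]; exact zero_mem _
    · rw [h.letter_notMem x hx v hv]
      exact LieSubalgebra.lie_mem _ (LieSubalgebra.subset_lieSpan ⟨v, rfl⟩) hx
  | zero => rw [map_zero]; exact zero_mem _
  | add a b _ _ ha hb => rw [map_add]; exact add_mem ha hb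
  | smul c a _ ha => rw [map_smul]; exact LieSubalgebra.smul_mem _ _ ha
  | lie a b ha' hb' ha hb =>
    have : T x ⁅a, b⁆ = ⁅T x a, b⁆ + ⁅a, T x b⁆ := by
      simp only [Ring.lie_def, map_sub, h.derivation hx]; abel
    rw [this]
    exact add_mem (LieSubalgebra.lie_mem _ ha hb') (LieSubalgebra.lie_mem _ ha' hb)

theorem antipode_apply (h : IsIharaTriangle V₀ T) {x : 𝓐} (hx : x ∈ lieElements V) (a : 𝓐) :
    antipode (T x a) = T x (antipode a) := by
  induction a with
  | grade0 r =>
    rw [h.apply_algebraMap_of_mem hx, Algebra.algebraMap_eq_smul_one, map_smul, antipode_one,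
      map_smul, h.apply_one_of_mem hx]; simp
  | grade1 v =>
    by_cases hv : v ∈ V₀
    · simp [h.letter_mem x hx v hv]
    · rw [antipode_ι, map_neg, h.letter_notMem x hx v hv, Ring.lie_def, map_sub, antipode_mul,
        antipode_mul, antipode_lie hx, antipode_ι]; noncomm_ring
  | mul a b ha hb =>
    rw [h.derivation hx, map_add, antipode_mul, antipode_mul, antipode_mul, h.derivation hx, ha,
      hb]; abel
  | add a b ha hb => simp only [map_add, ha, hb]

theorem counit_apply (h : IsIharaTriangle V₀ T) {x : 𝓐} (hx : x ∈ lieElements V) (a : 𝓐) :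
    FreeAlgebra.algebraMapInv (T x a) = 0 := by
  induction a with
  | grade0 r => simp [h.apply_algebraMap_of_mem hx]
  | grade1 v =>
    exact counit_lie (h.apply_mem hx (LieSubalgebra.subset_lieSpan ⟨v, rfl⟩))
  | mul a b ha hb => simp [h.derivation hx, ha, hb]
  | add a b ha hb => simp [ha, hb]

/-- `x ▷ -` is a coderivation for `x ∈ Lie(V)`. -/
theorem shuffleCoproduct_apply (h : IsIharaTriangle V₀ T) {x : 𝓐} (hx : x ∈ lieElements V)
    (a : 𝓐) : shuffleCoproduct (T x a) =
      TensorProduct.map (T x) LinearMap.id (shuffleCoproduct a) +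
      TensorProduct.map LinearMap.id (T x) (shuffleCoproduct a) := by
  induction a with
  | grade0 r =>
    rw [h.apply_algebraMap_of_mem hx, Algebra.algebraMap_eq_smul_one, map_smul, map_one,
      Algebra.TensorProduct.one_def]
    simp [h.apply_one_of_mem hx]
  | grade1 v =>
    rw [isPrimitive (h.apply_mem hx (LieSubalgebra.subset_lieSpan ⟨v, rfl⟩)), shuffleCoproduct_ι]
    simp [h.apply_one_of_mem hx]
  | mul a b ha hb =>
    rw [h.derivation hx, map_add, map_mul, map_mul, map_mul, ha, hb]
    generalize shuffleCoproduct a = s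
    generalize shuffleCoproduct b = t
    induction s with
    | zero => simp
    | add s s' hs hs' =>
      simp only [add_mul, map_add] at hs hs' ⊢
      have := congrArg₂ (· + ·) hs hs'; convert this using 1 <;> abel
    | tmul p q =>
      induction t with
      | zero => simp
      | add t t' hs hs' =>
        simp only [mul_add, map_add] at hs hs' ⊢
        have := congrArg₂ (· + ·) hs hs'; convert this using 1 <;> abel
      | tmul p' q' =>
        simp only [TensorProduct.map_tmul, Algebra.TensorProduct.tmul_mul_tmul, add_mul,
          mul_add, h.derivation hx, TensorProduct.add_tmul, TensorProduct.tmul_add,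
          LinearMap.id_apply]
        abel
  | add a b ha hb => simp only [map_add, ha, hb]; abel

/-- The products of `n` Lie elements span a subspace that `x ▷ -` preserves for `x ∈ Lie(V)`. -/
theorem apply_prod_mem_span (h : IsIharaTriangle V₀ T) {x : 𝓐} (hx : x ∈ lieElements V)
    (M : List 𝓐) (hM : ∀ m ∈ M, m ∈ lieElements V) :
    T x M.prod ∈ Submodule.span ℚ {p | ∃ N : List 𝓐, N.length = M.length ∧
      (∀ m ∈ N, m ∈ lieElements V) ∧ N.prod = p} := by
  induction M with
  | nil => rw [List.prod_nil, h.apply_one_of_mem hx]; exact zero_mem _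
  | cons m N ih =>
    rw [List.forall_mem_cons] at hM
    rw [List.prod_cons, h.derivation hx]
    refine add_mem (Submodule.subset_span ⟨T x m :: N, by simp, ?_, by simp⟩) ?_
    · exact List.forall_mem_cons.2 ⟨h.apply_mem hx hM.1, hM.2⟩
    · rw [← LinearMap.mulLeft_apply (R := ℚ), ← Submodule.mem_comap]
      refine Submodule.span_le.2 ?_ (ih hM.2)
      rintro _ ⟨P, hP, hP', rfl⟩
      exact Submodule.subset_span
        ⟨m :: P, by simp [hP], List.forall_mem_cons.2 ⟨hM.1, hP'⟩, by simp⟩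

/-- A subspace containing `1` and stable under the operators `A ↦ x A + x ▷ A = x ⊛ A`, for
`x ∈ Lie(V)`, is everything: modulo products of fewer Lie elements, `x ⊛ A` is `x A`. -/
theorem eq_top_of_forall_mem (h : IsIharaTriangle V₀ T) (P : Submodule ℚ 𝓐) (h1 : 1 ∈ P)
    (hP : ∀ x ∈ lieElements V, ∀ A ∈ P, x * A + T x A ∈ P) : P = ⊤ := by
  have key : ∀ n, ∀ M : List 𝓐, M.length = n → (∀ m ∈ M, m ∈ lieElements V) → M.prod ∈ P := by
    intro n
    induction n with
    | zero =>
      intro M hM _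
      rwa [List.length_eq_zero_iff.1 hM, List.prod_nil]
    | succ n ih =>
      intro M hM hM'
      obtain ⟨x, N, rfl⟩ := List.exists_cons_of_length_eq_add_one hM
      rw [List.forall_mem_cons] at hM'
      have hl : N.length = n := by simpa using hM
      have hT : T x N.prod ∈ P := by
        refine Submodule.span_le.2 ?_ (h.apply_prod_mem_span hM'.1 N hM'.2)
        rintro _ ⟨N', hN', hN, rfl⟩
        exact ih N' (hN'.trans hl) hN
      rw [List.prod_cons]
      simpa using sub_mem (hP x hM'.1 _ (ih N hl hM'.2)) hT
  refine eq_top_iff.2 fun A _ => ?_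
  induction A using word_induction with
  | zero => exact zero_mem _
  | add A B hA hB => exact add_mem (hA trivial) (hB trivial)
  | smul r A hA => exact Submodule.smul_mem _ _ (hA trivial)
  | word l =>
    refine key _ (l.map ιQ) rfl fun m hm => ?_
    obtain ⟨v, _, rfl⟩ := List.mem_map.1 hm
    exact LieSubalgebra.subset_lieSpan ⟨v, rfl⟩

/-- The action on a letter: `A ▷ v = (A ∣ 1) v` for `v ∈ V₀`, and `A ▷ v = S(A₍₁₎) v A₍₂₎`
otherwise. -/
theorem apply_ι (h : IsIharaTriangle V₀ T) (A : 𝓐) (v : V) :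
    T A (ιQ v) = letterAction V₀ v A := by
  suffices H : LinearMap.eqLocus (T.flip (ιQ v)) (letterAction V₀ v) = ⊤ by
    have : A ∈ LinearMap.eqLocus (T.flip (ιQ v)) (letterAction V₀ v) := H ▸ trivial
    exact this
  refine h.eq_top_of_forall_mem _ ?_ fun x hx A hA => ?_
  · rw [LinearMap.mem_eqLocus, LinearMap.flip_apply, h.one_apply]
    by_cases hv : v ∈ V₀ <;> simp [letterAction, hv, Algebra.TensorProduct.one_def]
  · rw [LinearMap.mem_eqLocus, LinearMap.flip_apply] at hA ⊢
    rw [map_add, LinearMap.add_apply,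
      h.mul_apply x hx _ (LieSubalgebra.subset_lieSpan ⟨v, rfl⟩), sub_add_cancel, hA]
    by_cases hv : v ∈ V₀
    · simp [letterAction, hv, counit_lie hx, h.counit_apply hx, h.letter_mem x hx v hv]
    · have hxv : T x (ιQ v) = ιQ v * x - x * ιQ v := h.letter_notMem x hx v hv
      simp only [letterAction, hv, if_false, LinearMap.comp_apply, AlgHom.toLinearMap_apply,
        map_add, h.shuffleCoproduct_apply hx, map_mul, isPrimitive hx]
      generalize shuffleCoproduct A = s
      induction s with
      | zero => simp
      | add s s' hs hs' =>
        simp only [mul_add, map_add] at hs hs' ⊢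
        rw [hs, hs']; abel
      | tmul p q =>
        simp only [TensorProduct.map_tmul, Algebra.TensorProduct.tmul_mul_tmul, add_mul,
          map_add, conjAux_tmul, h.derivation hx, antipode_mul, h.antipode_apply hx, hxv,
          antipode_lie hx, LinearMap.id_apply, one_mul]
        noncomm_ring

attribute [local instance] bialg in
theorem apply_word (h : IsIharaTriangle V₀ T) (A : 𝓐) (l : List V) :
    T A (word l) = ((l.map (convAction V₀)).prod).ofConv A := by
  induction l generalizing A with
  | nil => rw [word_nil, h.apply_one, List.map_nil, List.prod_nil, conv_one_apply,
      Algebra.algebraMap_eq_smul_one]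
  | cons b l ih =>
    have h1 : T.flip (ιQ b) = (convAction V₀ b).ofConv :=
      LinearMap.ext fun A => (h.apply_ι A b).trans (convAction_apply V₀ b A).symm
    have h2 : T.flip (word l) = ((l.map (convAction V₀)).prod).ofConv := LinearMap.ext ih
    rw [word_cons, h.apply_mul, List.map_cons, List.prod_cons, conv_mul_apply, h1, h2]

end IsIharaTriangle

attribute [local instance] bialg in
theorem grossmanLarson_word (V₀ : Set V) (A : 𝓐) (l : List V) :
    grossmanLarson V₀ A (word l) = (convProd V₀ False True l).ofConv A := by
  have h1 : (triangle V₀).flip (word l) = ((l.map (convAction V₀)).prod).ofConv :=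
    LinearMap.ext fun B => (isIharaTriangle_triangle V₀).apply_word B l
  have h2 : convProd V₀ False True l = convId * (l.map (convAction V₀)).prod := by
    simp [convProd, leftEnd, rightEnd]
  rw [h2, conv_mul_apply, grossmanLarson, h1]
  rfl

end Lie

/-! ### Sums over sets of positions -/

/-- A sum over the sets `J` of positions `≥ m`, split according to the first element of `J`. -/
theorem sum_powerset_sort {M : Type*} [AddCommMonoid M] {n : ℕ} (f : List (Fin n) → M) (m : ℕ) :
    ∑ J ∈ (Finset.univ.filter fun i : Fin n => m ≤ i).powerset, f (J.sort (· ≤ ·)) =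
      f [] + ∑ i ∈ Finset.univ.filter (fun i : Fin n => m ≤ i),
        ∑ J ∈ (Finset.univ.filter fun k : Fin n => i + 1 ≤ k.1).powerset,
          f (i :: J.sort (· ≤ ·)) := by
  rcases le_total n m with hm | hm
  · have : (Finset.univ.filter fun i : Fin n => m ≤ i) = ∅ :=
      Finset.filter_eq_empty_iff.2 fun i _ => by omega
    simp [this]
  · induction hm using Nat.decreasingInduction with
    | self =>
      have : (Finset.univ.filter fun i : Fin n => n ≤ i) = ∅ :=
        Finset.filter_eq_empty_iff.2 fun i _ => by omega
      simp [this]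
    | of_succ m hm ih =>
      have hins : (Finset.univ.filter fun i : Fin n => m ≤ i) =
          insert ⟨m, hm⟩ (Finset.univ.filter fun i : Fin n => m + 1 ≤ i) := by
        ext i; simp [Fin.ext_iff]; omega
      have hnot : (⟨m, hm⟩ : Fin n) ∉ Finset.univ.filter fun i : Fin n => m + 1 ≤ i := by simp
      rw [hins, Finset.sum_powerset_insert hnot, Finset.sum_insert hnot, ih, add_assoc,
        add_comm (∑ i ∈ _, _)]
      congr 2
      refine Finset.sum_congr rfl fun J hJ => ?_
      have hJ' : ∀ i ∈ J, m + 1 ≤ i.1 := fun i hi => by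
        simpa using Finset.mem_powerset.1 hJ hi
      rw [Finset.sort_insert (· ≤ ·) (fun i hi => Fin.le_def.2 (by have := hJ' i hi; simp; omega))
        (fun h => by have := hJ' _ h; simp at this)]

/-- The word `a_{j₁} ⋯ a_{jₖ}` in terms of the sorted list of positions. -/
theorem subword_eq {n : ℕ} (a : Fin n → V) (J : Finset (Fin n)) :
    subword a J = word ((J.sort (· ≤ ·)).map a) := by
  rw [subword, ← Finset.listMap_orderEmbOfFin_finRange J rfl, List.map_map, List.ofFn_eq_map]
  rfl

/-- For positions `r` and `L = [j₁, …, jₖ]`, the shuffle product of the symbols of the intervals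
between consecutive elements of `r, j₁ + 1, …, jₖ + 1, n + 1`. -/
def chainProd (V₀ : Set V) (p q : Prop) {n : ℕ} (a : Fin n → V) : ℕ → List (Fin n) → 𝓐
  | r, [] => symbol (memAt V₀ p q a r) (memAt V₀ p q a (n + 1)) (segment a r (n + 1))
  | r, i :: L => shuffle (symbol (memAt V₀ p q a r) (memAt V₀ p q a (i + 1))
      (segment a r (i + 1))) (chainProd V₀ p q a (i + 1) L)

theorem shuffleProd_range_eq_chainProd (V₀ : Set V) (p q : Prop) {n : ℕ} (a : Fin n → V)
    (L : List (Fin n)) (c : ℕ → ℕ)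
    (hc : ∀ k (h : k < L.length), c (k + 1) = L[k] + 1) (hlast : c (L.length + 1) = n + 1) :
    shuffleProd ((List.range (L.length + 1)).map fun r =>
      symbol (memAt V₀ p q a (c r)) (memAt V₀ p q a (c (r + 1))) (segment a (c r) (c (r + 1)))) =
      chainProd V₀ p q a (c 0) L := by
  induction L generalizing c with
  | nil =>
    have : c 1 = n + 1 := by simpa using hlast
    simp [shuffleProd, chainProd, this]
  | cons i L ih =>
    have h1 : c 1 = i + 1 := hc 0 (by simp)
    have := ih (fun k => c (k + 1)) (fun k hk => hc (k + 1) (by simpa using hk))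
      (by simpa using hlast)
    rw [List.length_cons, List.range_succ_eq_map, List.map_cons, List.map_map, shuffleProd,
      List.foldr_cons, chainProd, ← h1, ← this]
    rfl

theorem symbolProd_eq (V₀ : Set V) (p q : Prop) {n : ℕ} (a : Fin n → V) (J : Finset (Fin n)) :
    symbolProd V₀ p q a J = chainProd V₀ p q a 0 (J.sort (· ≤ ·)) := by
  have := shuffleProd_range_eq_chainProd V₀ p q a (J.sort (· ≤ ·)) (cut J) (fun k hk => ?_) ?_
  · rw [Finset.length_sort] at this
    exact this
  · rw [Finset.length_sort] at hk
    simp [cut, hk, Finset.orderEmbOfFin_apply]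
  · simp [cut]

/-! ### The coproduct of a word -/

/-- Symbols are self-adjoint. -/
theorem pairing_symbol (p q : Prop) (A B : 𝓐) :
    pairing (symbol p q A) B = pairing A (symbol p q B) := by
  unfold symbol
  split_ifs
  · rfl
  · exact pairing_antipode A B
  · simp [pairing_comm 1, mul_comm]

/-- Contraction of the second tensor factor with `B`. -/
def contract (B : 𝓐) : 𝓐 ⊗[ℚ] 𝓐 →ₗ[ℚ] 𝓐 :=
  (TensorProduct.rid ℚ 𝓐).toLinearMap ∘ₗ TensorProduct.map LinearMap.id (pairing B)

theorem pairing_contract (A B : 𝓐) (t : 𝓐 ⊗[ℚ] 𝓐) :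
    pairing A (contract B t) = pairing₂ A B t := by
  induction t with
  | zero => simp
  | add s t hs ht => simp [hs, ht]
  | tmul C D => simp [contract, mul_comm]

theorem contract_word_cons_map [DecidableEq V] (b x : V) (l : List V) (f : 𝓐) (t : 𝓐 ⊗[ℚ] 𝓐) :
    contract (word (b :: l)) (TensorProduct.map (shuffle f) (LinearMap.mulLeft ℚ (ιQ x)) t) =
      if b = x then shuffle f (contract (word l) t) else 0 := by
  induction t with
  | zero => simp
  | add s t hs ht => simp only [map_add, hs, ht]; split_ifs <;> simp
  | tmul C D =>
    have : pairing (word (b :: l)) (ιQ x * D) = if x = b then pairing D (word l) else 0 := by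
      rw [pairing_comm, pairing_ι_mul_word_cons]
      simp only [eq_comm]
    simp only [contract, LinearMap.comp_apply, TensorProduct.map_tmul, LinearMap.mulLeft_apply,
      LinearMap.id_apply, this, eq_comm (a := x), pairing_comm (word l)]
    split_ifs <;> simp

theorem contract_one_map (x : V) (f : 𝓐) (t : 𝓐 ⊗[ℚ] 𝓐) :
    contract 1 (TensorProduct.map (shuffle f) (LinearMap.mulLeft ℚ (ιQ x)) t) = 0 := by
  induction t with
  | zero => simp
  | add s t hs ht => simp only [map_add, hs, ht, add_zero]
  | tmul C D => simp [contract, pairing_comm 1, pairing_ι_mul_one]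

theorem memAt_succ (V₀ : Set V) (p q : Prop) {n : ℕ} (a : Fin n → V) (i : Fin n) :
    memAt V₀ p q a (i + 1) = (a i ∈ V₀) := by
  simp [memAt]

theorem memAt_last (V₀ : Set V) (p q : Prop) {n : ℕ} (a : Fin n → V) :
    memAt V₀ p q a (n + 1) = q := by
  simp [memAt]

theorem segment_last {n : ℕ} (a : Fin n → V) (r : ℕ) :
    segment a r (n + 1) = word ((List.ofFn a).drop r) := by
  rw [segment, Nat.add_sub_cancel, List.take_of_length_le (by simp)]

/-- The sum over the sets of positions `> r` that computes the coproduct of `aᵣ₊₁ ⋯ aₙ` with left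
endpoint `aᵣ`. -/
def cutSum (V₀ : Set V) (p q : Prop) {n : ℕ} (a : Fin n → V) (r : ℕ) : 𝓐 ⊗[ℚ] 𝓐 :=
  ∑ J ∈ (Finset.univ.filter fun i : Fin n => r ≤ i).powerset,
    chainProd V₀ p q a r (J.sort (· ≤ ·)) ⊗ₜ[ℚ] word ((J.sort (· ≤ ·)).map a)

theorem sum_symbolProd_tmul_subword (V₀ : Set V) (p q : Prop) {n : ℕ} (a : Fin n → V) :
    ∑ J : Finset (Fin n), symbolProd V₀ p q a J ⊗ₜ[ℚ] subword a J = cutSum V₀ p q a 0 := by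
  simp [cutSum, symbolProd_eq, subword_eq]

theorem cutSum_eq (V₀ : Set V) (p q : Prop) {n : ℕ} (a : Fin n → V) (r : ℕ) :
    cutSum V₀ p q a r = symbol (memAt V₀ p q a r) q (word ((List.ofFn a).drop r)) ⊗ₜ 1 +
      ∑ i ∈ Finset.univ.filter (fun i : Fin n => r ≤ i),
        TensorProduct.map
          (shuffle (symbol (memAt V₀ p q a r) (a i ∈ V₀) (segment a r (i + 1))))
          (LinearMap.mulLeft ℚ (ιQ (a i))) (cutSum V₀ p q a (i + 1)) := by
  rw [cutSum, sum_powerset_sort (fun L => chainProd V₀ p q a r L ⊗ₜ[ℚ] word (L.map a))]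
  congr 1
  · simp [chainProd, memAt_last, segment_last]
  · refine Finset.sum_congr rfl fun i _ => ?_
    rw [cutSum, map_sum]
    refine Finset.sum_congr rfl fun J _ => ?_
    simp [chainProd, memAt_succ]

theorem pairing_mul_ι_mul_word_drop [DecidableEq V] {n : ℕ} (a : Fin n → V) (r : ℕ) (hr : r ≤ n)
    (X Y : 𝓐) (b : V) : pairing (X * (ιQ b * Y)) (word ((List.ofFn a).drop r)) =
      ∑ i ∈ Finset.univ.filter (fun i : Fin n => r ≤ i),
        if b = a i then
          pairing X (segment a r (i + 1)) * pairing Y (word ((List.ofFn a).drop (i + 1)))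
        else 0 := by
  rw [pairing_mul_word, Finset.sum_range_succ, List.drop_length, word_nil, pairing_ι_mul_one,
    mul_zero, add_zero, List.length_drop, List.length_ofFn]
  refine Finset.sum_bij (fun i hi => ⟨r + i, by simp at hi; omega⟩) (fun i _ => by simp)
    (fun i _ j _ h => by simpa using h) (fun i hi => ⟨i - r, ?_, ?_⟩) fun i hi => ?_
  · simp at hi; simp; omega
  · simp at hi; simp [Fin.ext_iff]; omega
  · have hi' : r + i < n := by simp at hi; omega
    have h1 : (List.drop r (List.ofFn a)).drop i =
        a ⟨r + i, hi'⟩ :: (List.ofFn a).drop (r + i + 1) := by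
      rw [List.drop_drop, List.drop_eq_getElem_cons (by simpa using hi')]; simp
    have h2 : (List.drop r (List.ofFn a)).take i = ((List.ofFn a).take (r + i)).drop r := by
      rw [List.drop_take]; congr 1; omega
    rw [h1, h2, pairing_ι_mul_word_cons, segment]
    simp

attribute [local instance] bialg in
/-- The sum over the sets of positions is dual to `A ↦ A₍₁₎ (A₍₂₎ ▷ w)`: both recursions peel off the
first letter of `w`, which is the letter at the first of the positions. -/
theorem pairing₂_cutSum (V₀ : Set V) (p q : Prop) {n : ℕ} (a : Fin n → V) (l : List V) (r : ℕ)
    (hr : r ≤ n) (A : 𝓐) : pairing₂ A (word l) (cutSum V₀ p q a r) =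
      pairing ((convProd V₀ (memAt V₀ p q a r) q l).ofConv A) (word ((List.ofFn a).drop r)) := by
  classical
  induction l generalizing r A with
  | nil =>
    rw [cutSum_eq, map_add, map_sum, Finset.sum_eq_zero, add_zero, pairing₂_tmul, convProd_nil,
      word_nil, pairing_symbol]
    · simp [pairing_one]
    · intro i _
      rw [word_nil, ← pairing_contract, contract_one_map, map_zero]
  | cons b l ih =>
    have hzero : pairing (word (b :: l)) 1 = 0 := by rw [word_cons, pairing_ι_mul_one]
    rw [cutSum_eq, map_add, map_sum, pairing₂_tmul, hzero, mul_zero, zero_add, convProd_cons]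
    have key : ∀ (f : 𝓐 →ₗ[ℚ] 𝓐) (g : WithConv (𝓐 →ₗ[ℚ] 𝓐)) (t : 𝓐 ⊗[ℚ] 𝓐),
        pairing (LinearMap.mul' ℚ 𝓐 (TensorProduct.map f (convLetter b * g).ofConv t))
          (word ((List.ofFn a).drop r)) =
        ∑ i ∈ Finset.univ.filter (fun i : Fin n => r ≤ i),
          if b = a i then
            LinearMap.mul' ℚ ℚ (TensorProduct.map (pairing.flip (segment a r (i + 1)) ∘ₗ f)
              (pairing.flip (word ((List.ofFn a).drop (i + 1))) ∘ₗ g.ofConv) t)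
          else 0 := by
      intro f g t
      induction t with
      | zero => simp
      | add s t hs ht =>
        simp only [map_add, LinearMap.add_apply, hs, ht, ← Finset.sum_add_distrib]
        refine Finset.sum_congr rfl fun i _ => ?_
        split_ifs <;> simp
      | tmul B C =>
        rw [TensorProduct.map_tmul, LinearMap.mul'_apply, convLetter_mul_apply,
          pairing_mul_ι_mul_word_drop a r hr]
        simp
    have hconv : ∀ i ∈ Finset.univ.filter (fun i : Fin n => r ≤ i), b = a i →
        pairing (contract (word l) (cutSum V₀ p q a (i + 1))) =
          pairing.flip (word ((List.ofFn a).drop (i + 1))) ∘ₗ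
            (convProd V₀ (a i ∈ V₀) q l).ofConv := by
      intro i _ _
      refine LinearMap.ext fun B => ?_
      rw [pairing_comm, pairing_contract, ih (i + 1) (by omega), memAt_succ]
      rfl
    rw [conv_mul_apply, key]
    refine Finset.sum_congr rfl fun i hi => ?_
    rw [← pairing_contract, contract_word_cons_map]
    split_ifs with h
    · have hs : pairing (symbol (memAt V₀ p q a r) (a i ∈ V₀) (segment a r (i + 1))) =
          pairing.flip (segment a r (i + 1)) ∘ₗ symbol (memAt V₀ p q a r) (a i ∈ V₀) :=
        LinearMap.ext fun B => by
          rw [pairing_comm, LinearMap.comp_apply, LinearMap.flip_apply, pairing_symbol]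
      rw [pairing_shuffle, pairing₂, hconv i hi h, hs, h]
      rfl
    · simp

/-- The formula for the coproduct of a word. -/
theorem coproduct_word_ofFn (V₀ : Set V) {n : ℕ} (a : Fin n → V) :
    coproduct V₀ (word (List.ofFn a)) =
      ∑ J : Finset (Fin n), symbolProd V₀ False True a J ⊗ₜ[ℚ] subword a J := by
  rw [sum_symbolProd_tmul_subword, coproduct, constr_word]
  conv_rhs => rw [← finsum_pairing₂ (cutSum V₀ False True a 0)]
  refine finsum_congr fun p => ?_
  rw [pairing₂_cutSum _ _ _ _ _ _ (Nat.zero_le n), grossmanLarson_word]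
  rfl

theorem exists_ofFn_eq (l : List V) : ∃ (n : ℕ) (a : Fin n → V), List.ofFn a = l :=
  ⟨l.length, l.get, List.ofFn_get l⟩

/-- `Δ_I` is dual to the Grossman-Larson product. -/
theorem pairing_grossmanLarson (V₀ : Set V) (A B C : 𝓐) :
    pairing (grossmanLarson V₀ A B) C = pairing₂ A B (coproduct V₀ C) := by
  induction B using word_induction with
  | zero => simp [grossmanLarson, pairing₂_zero_right]
  | add B B' h h' =>
    rw [pairing₂_add_right, ← h, ← h', ← LinearMap.add_apply, ← map_add]
    simp [grossmanLarson, TensorProduct.map_add_right]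
  | smul r B h =>
    rw [pairing₂_smul_right, ← h, ← smul_eq_mul, ← LinearMap.smul_apply, ← map_smul]
    simp [grossmanLarson, TensorProduct.map_smul_right]
  | word w =>
    induction C using word_induction with
    | zero => simp
    | add C C' h h' => simp [h, h']
    | smul r C h => simp [h]
    | word c =>
      obtain ⟨n, a, rfl⟩ := exists_ofFn_eq c
      rw [coproduct_word_ofFn, sum_symbolProd_tmul_subword,
        pairing₂_cutSum _ _ _ _ _ _ (Nat.zero_le n), grossmanLarson_word]
      rfl

/-! ### Symbols as a Goncharov system -/

theorem symbol_of_iff {p q : Prop} (h : p ↔ q) (A : 𝓐) : symbol p q A = pairing A 1 • 1 := by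
  have h1 : ¬(¬p ∧ q) := by tauto
  have h2 : ¬(p ∧ ¬q) := by tauto
  simp [symbol, h1, h2]

theorem symbol_false_true : (symbol False True : 𝓐 →ₗ[ℚ] 𝓐) = LinearMap.id := by
  simp [symbol]

theorem symbol_true_false : (symbol True False : 𝓐 →ₗ[ℚ] 𝓐) = antipode := by
  simp [symbol]

@[simp] theorem symbol_one (p q : Prop) : symbol p q (1 : 𝓐) = 1 := by
  unfold symbol
  split_ifs <;> simp [pairing_one]

/-- Symbols are endomorphisms of the shuffle algebra. -/
theorem symbol_shuffle (p q : Prop) (f g : 𝓐) :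
    shuffle (symbol p q f) (symbol p q g) = symbol p q (shuffle f g) := by
  unfold symbol
  split_ifs
  · rfl
  · exact (antipode_shuffle f g).symm
  · simp [counit_shuffle, smul_smul, mul_comm]

attribute [local instance] bialg in
theorem rightEnd_mul_leftEnd (p : Prop) :
    (rightEnd p * leftEnd p : WithConv (𝓐 →ₗ[ℚ] 𝓐)) = 1 := by
  by_cases hp : p <;> simp [leftEnd, rightEnd, hp, convAntipode_mul_convId]

attribute [local instance] bialg in
/-- Path composition: at the inner point `x` the endpoint factors cancel, as `S * id = 1`. -/
theorem symbol_word_eq_sum (p x q : Prop) (w : List V) :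
    symbol p q (word w) = ∑ i ∈ Finset.range (w.length + 1),
      shuffle (symbol p x (word (w.take i))) (symbol x q (word (w.drop i))) := by
  refine ext_pairing fun C => ?_
  have hconv : WithConv.toConv (symbol p q) =
      (WithConv.toConv (symbol p x) * WithConv.toConv (symbol x q) :
        WithConv (𝓐 →ₗ[ℚ] 𝓐)) := by
    rw [← leftEnd_mul_rightEnd, ← leftEnd_mul_rightEnd, ← leftEnd_mul_rightEnd, mul_assoc,
      ← mul_assoc (rightEnd x), rightEnd_mul_leftEnd, one_mul]
  have h := congrArg (fun f => pairing (f.ofConv C) (word w)) hconv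
  simp only [conv_mul_apply, pairing_symbol] at h
  rw [h, map_sum]
  simp only [pairing_shuffle]
  generalize shuffleCoproduct C = t
  induction t with
  | zero => simp
  | add s t hs ht => simp only [map_add, LinearMap.add_apply, hs, ht, Finset.sum_add_distrib]
  | tmul A B =>
    rw [TensorProduct.map_tmul, LinearMap.mul'_apply, pairing_mul_word]
    refine Finset.sum_congr rfl fun i _ => ?_
    rw [pairing_symbol, pairing_symbol, pairing₂_tmul, pairing_comm A, pairing_comm B]

theorem pairing_word_one {w : List V} (hw : w ≠ []) : pairing (word w) 1 = 0 := by
  obtain ⟨x, l, rfl⟩ := List.exists_cons_of_ne_nil hw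
  rw [word_cons, pairing_ι_mul_one]

theorem isGoncharovSystem_binarySymbol :
    IsGoncharovSystem shuffle 1 binarySymbol where
  unit _ _ := symbol_one _ _
  shuffle_mul _ _ f g := symbol_shuffle _ _ f g
  path _ _ _ w := symbol_word_eq_sum _ _ _ w
  loop a w hw := by rw [binarySymbol, symbol_of_iff Iff.rfl, pairing_word_one hw, zero_smul]

namespace IsGoncharovSystem

variable {S R : Type*} [CommRing R] [Algebra ℚ R] {𝕀 : S → S → FreeAlgebra ℚ S →ₗ[ℚ] R}

theorem apply_self (h : IsGoncharovSystem (LinearMap.mul ℚ R) 1 𝕀) (a : S)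
    (f : FreeAlgebra ℚ S) : 𝕀 a a f = pairing f 1 • 1 := by
  suffices H : 𝕀 a a = (pairing.flip 1).smulRight 1 from LinearMap.congr_fun H f
  refine linearMap_ext_word fun l => ?_
  by_cases hl : l = []
  · simp [hl, h.unit, pairing_one]
  · simp [h.loop a l hl, pairing_word_one hl]

/-- Reversal of paths. By path composition and the vanishing of loops, `𝕀(a; -; b)` is the
convolution inverse of `𝕀(b; -; a)`, and so is `𝕀(b; S(-); a)`. -/
theorem apply_antipode (h : IsGoncharovSystem (LinearMap.mul ℚ R) 1 𝕀) (a b : S)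
    (f : FreeAlgebra ℚ S) : 𝕀 b a (antipode f) = 𝕀 a b f := by
  suffices H : 𝕀 b a ∘ₗ antipode = 𝕀 a b from LinearMap.congr_fun H f
  refine linearMap_ext_word fun w => ?_
  rw [LinearMap.comp_apply]
  induction hn : w.length using Nat.strong_induction_on generalizing w with
  | _ n ih =>
    subst hn
    have h1 := h.path a b a w
    have h2 := congrArg (𝕀 b a) (symbol_word_eq_sum True False True w)
    rw [map_sum, symbol_of_iff Iff.rfl, map_smul, h.unit, ← h.apply_self a, h1] at h2
    simp only [symbol_true_false, symbol_false_true, ← h.shuffle_mul] at h2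
    -- The last terms of the two sums are the two sides; the other terms agree by induction.
    rw [Finset.sum_range_succ, Finset.sum_range_succ] at h2
    have h3 : ∀ i ∈ Finset.range w.length,
        LinearMap.mul ℚ R (𝕀 b a (antipode (word (w.take i)))) (𝕀 b a (word (w.drop i))) =
          LinearMap.mul ℚ R (𝕀 a b (word (w.take i))) (𝕀 b a (word (w.drop i))) := by
      intro i hi
      rw [Finset.mem_range] at hi
      rw [ih i hi (w.take i) (by simp [hi.le])]
    simp only [LinearMap.id_apply, Finset.sum_congr rfl h3] at h2
    simpa [h.unit] using (add_left_cancel h2).symm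

end IsGoncharovSystem

theorem binarySymbol_one_zero : binarySymbol 1 0 = LinearMap.id := by
  simp [binarySymbol, symbol]

theorem binarySymbol_zero_one : binarySymbol 0 1 = antipode := by
  simp [binarySymbol, symbol]

theorem binarySymbol_self (s : Fin 2) (f : FreeAlgebra ℚ (Fin 2)) :
    binarySymbol s s f = pairing f 1 • 1 := symbol_of_iff Iff.rfl f

/-- The shuffle algebra with its symbols is the universal Goncharov system. -/
theorem IsGoncharovSystem.existsUnique {R : Type*} [CommRing R] [Algebra ℚ R]
    {𝕀 : Fin 2 → Fin 2 → FreeAlgebra ℚ (Fin 2) →ₗ[ℚ] R}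
    (h : IsGoncharovSystem (LinearMap.mul ℚ R) 1 𝕀) :
    ∃! φ : FreeAlgebra ℚ (Fin 2) →ₗ[ℚ] R, φ 1 = 1 ∧ (∀ f g, φ (shuffle f g) = φ f * φ g) ∧
      ∀ s t f, φ (binarySymbol s t f) = 𝕀 s t f := by
  refine ⟨𝕀 1 0, ⟨h.unit 1 0, fun f g => (h.shuffle_mul 1 0 f g).symm, fun s t f => ?_⟩,
    fun φ hφ => LinearMap.ext fun f => ?_⟩
  · have hself : ∀ s, 𝕀 1 0 (binarySymbol s s f) = 𝕀 s s f := fun s => by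
      rw [binarySymbol_self, map_smul, h.unit, h.apply_self]
    fin_cases s <;> fin_cases t
    · exact hself 0
    · exact (congrArg (fun g => 𝕀 1 0 (g f)) binarySymbol_zero_one).trans (h.apply_antipode 0 1 f)
    · exact congrArg (fun g => 𝕀 1 0 (g f)) binarySymbol_one_zero
    · exact hself 1
  · rw [← hφ.2.2 1 0 f, binarySymbol_one_zero, LinearMap.id_apply]

/-! ### The coproduct of a symbol -/

theorem pairing₂_map_id_antipode (A B : 𝓐) (t : 𝓐 ⊗[ℚ] 𝓐) :
    pairing₂ A B (TensorProduct.map LinearMap.id antipode t) = pairing₂ A (antipode B) t := by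
  induction t with
  | zero => simp
  | add s t hs ht => simp only [map_add, hs, ht]
  | tmul C D => simp [pairing_antipode]

/-- The antipode is moved through the Grossman-Larson product, where it reverses the order of the
endpoints and of the letters. -/
theorem coproduct_antipode_word (V₀ : Set V) {n : ℕ} (a : Fin n → V) :
    coproduct V₀ (antipode (word (List.ofFn a))) =
      TensorProduct.map LinearMap.id antipode (cutSum V₀ True False a 0) := by
  refine ext_pairing₂ fun l m => ?_
  rw [← pairing_grossmanLarson, ← pairing_antipode, grossmanLarson_word, antipode_convProd,
    pairing₂_map_id_antipode, antipode_word, pairing₂_smul_right,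
    pairing₂_cutSum _ _ _ _ _ _ (Nat.zero_le n)]
  simp [memAt]

theorem coproduct_one (V₀ : Set V) : coproduct V₀ 1 = 1 ⊗ₜ[ℚ] 1 := by
  have := coproduct_word_ofFn V₀ (Fin.elim0 : Fin 0 → V)
  rw [sum_symbolProd_tmul_subword, cutSum_eq] at this
  simpa using this

theorem map_id_symbol_cutSum (V₀ : Set V) {p q : Prop} (h : p ↔ q) {n : ℕ} (a : Fin n → V) :
    TensorProduct.map LinearMap.id (symbol p q) (cutSum V₀ p q a 0) =
      pairing (word (List.ofFn a)) 1 • (1 ⊗ₜ[ℚ] 1) := by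
  have hzero : ∀ (f : 𝓐 →ₗ[ℚ] 𝓐) (x : V) (t : 𝓐 ⊗[ℚ] 𝓐), TensorProduct.map LinearMap.id
      (symbol p q) (TensorProduct.map f (LinearMap.mulLeft ℚ (ιQ x)) t) = 0 := by
    intro f x t
    induction t with
    | zero => simp
    | add s t hs ht => simp only [map_add, hs, ht, add_zero]
    | tmul C D => simp [symbol_of_iff h, pairing_ι_mul_one]
  rw [cutSum_eq, map_add, map_sum, Finset.sum_eq_zero fun i _ => hzero _ _ _, add_zero]
  simp [memAt, symbol_of_iff h, pairing_one, TensorProduct.smul_tmul']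

/-- The coproduct of a symbol, for any endpoints. -/
theorem coproduct_symbol_word (V₀ : Set V) (p q : Prop) {n : ℕ} (a : Fin n → V) :
    coproduct V₀ (symbol p q (word (List.ofFn a))) =
      ∑ J : Finset (Fin n), symbolProd V₀ p q a J ⊗ₜ[ℚ] symbol p q (subword a J) := by
  have hsum : ∑ J : Finset (Fin n), symbolProd V₀ p q a J ⊗ₜ[ℚ] symbol p q (subword a J) =
      TensorProduct.map LinearMap.id (symbol p q) (cutSum V₀ p q a 0) := by
    rw [← sum_symbolProd_tmul_subword, map_sum]
    rfl
  rw [hsum]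
  by_cases h : p ↔ q
  · rw [map_id_symbol_cutSum V₀ h, symbol_of_iff h, map_smul, coproduct_one]
  · by_cases hp : p
    · have hq : ¬q := by tauto
      obtain rfl := eq_true hp
      obtain rfl := eq_false hq
      rw [symbol_true_false, coproduct_antipode_word]
    · have hq : q := by tauto
      obtain rfl := eq_false hp
      obtain rfl := eq_true hq
      rw [symbol_false_true, LinearMap.id_apply, coproduct_word_ofFn,
        sum_symbolProd_tmul_subword, TensorProduct.map_id, LinearMap.id_apply]

end Ihara

end

theorem theorem4p15 {V : Type*} (V₀ : Set V) :
    -- `Δ_I` is dual to the Grossman-Larson product, and it is the only such map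
    ((∀ A B C : FreeAlgebra ℚ V, Ihara.pairing (Ihara.grossmanLarson V₀ A B) C =
        Ihara.pairing₂ A B (Ihara.coproduct V₀ C)) ∧
      ∀ D : FreeAlgebra ℚ V →ₗ[ℚ] FreeAlgebra ℚ V ⊗[ℚ] FreeAlgebra ℚ V,
        (∀ A B C : FreeAlgebra ℚ V, Ihara.pairing (Ihara.grossmanLarson V₀ A B) C =
          Ihara.pairing₂ A B (D C)) → D = Ihara.coproduct V₀) ∧
    -- the formula, with formal end letters `a₀ ∉ V₀` and `aₙ₊₁ ∈ V₀`
    (∀ (n : ℕ) (a : Fin n → V), Ihara.coproduct V₀ (Ihara.word (List.ofFn a)) =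
      ∑ J : Finset (Fin n), Ihara.symbolProd V₀ False True a J ⊗ₜ[ℚ] Ihara.subword a J) ∧
    -- for `{v₀, v₁}` and `{v₀}`, the shuffle algebra with its symbols is Goncharov's algebra
    Ihara.IsGoncharovSystem Ihara.shuffle 1 Ihara.binarySymbol ∧
    (∀ (R : Type*) [CommRing R] [Algebra ℚ R]
      (𝕀 : Fin 2 → Fin 2 → FreeAlgebra ℚ (Fin 2) →ₗ[ℚ] R),
      Ihara.IsGoncharovSystem (LinearMap.mul ℚ R) 1 𝕀 →
      ∃! φ : FreeAlgebra ℚ (Fin 2) →ₗ[ℚ] R, φ 1 = 1 ∧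
        (∀ f g, φ (Ihara.shuffle f g) = φ f * φ g) ∧
        ∀ s t f, φ (Ihara.binarySymbol s t f) = 𝕀 s t f) ∧
    -- and `Δ_I` is Goncharov's coproduct on it, with the tensor factors swapped
    (∀ (n : ℕ) (s t : Fin 2) (a : Fin n → Fin 2),
      Ihara.coproduct {0} (Ihara.binarySymbol s t (Ihara.word (List.ofFn a))) =
        ∑ J : Finset (Fin n), Ihara.symbolProd {0} (s ∈ ({0} : Set (Fin 2)))
          (t ∈ ({0} : Set (Fin 2))) a J ⊗ₜ[ℚ] Ihara.binarySymbol s t (Ihara.subword a J)) := by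
  refine ⟨⟨Ihara.pairing_grossmanLarson V₀, fun D hD => LinearMap.ext fun C => ?_⟩,
    fun n a => Ihara.coproduct_word_ofFn V₀ a, Ihara.isGoncharovSystem_binarySymbol,
    fun R _ _ 𝕀 h𝕀 => h𝕀.existsUnique,
    fun n s t a => Ihara.coproduct_symbol_word {0} _ _ a⟩
  exact Ihara.ext_pairing₂ fun l m => by rw [← hD, Ihara.pairing_grossmanLarson]
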